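/- **Setting.** Let $(G_j)_{j\in\mathbb N}$ be a sequence of finite, weighted, connected, undirected graphs $G_j=(V,E,(c_{xy})_{xy\in E})$ with conductances $c_{xy}>0$, and let $n=n_j=|V|\to\infty$ as $j\to\infty$. Each $G_j$ carries site-weights $\pi=(\pi(x))_{x\in V}$ with $\pi(x)>0$ and $\sum_x\pi(x)=1$. (The dependence on $j$ is omitted from the notation.) For $p\in[1,\infty)$ and $\psi:V\to\mathbb R$ let $\|\psi\|_p=\big(\sum_x\pi(x)|\psi(x)|^p\big)^{1/p}$. *Single particle.* Let $$L f=\sum_{xy\in E}c_{xy}(P_{xy}f-f),$$ where $P_{xy}f(z)=\frac{\pi(x)f(x)+\pi(y)f(y)}{\pi(x)+\pi(y)}$ if $z\in\{x,y\}$ and $P_{xy}f(z)=f(z)$ otherwise. Let $$\mathcal E(\psi)=\sum_{xy\in E}c_{xy}\frac{\pi(x)\pi(y)}{\pi(x)+\pi(y)}(\psi(x)-\psi(y))^2$$ be its Dirichlet form, let $$\mathrm{gap}=\inf\Big\{\tfrac{\sum_x\pi(x)f(x)(-Lf)(x)}{\sum_x\pi(x)f(x)^2}:\ f\ne0,\ \sum_x\pi(x)f(x)=0\Big\}$$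 be its spectral gap, and let $t_{\rm rel}=\mathrm{gap}^{-1}$. *Averaging process.* Let $\Delta$ be the set of probability distributions on $V$. The Averaging process $(\eta_t)_{t\ge0}$ is the Markov process on $\Delta$ with generator $f\mapsto\sum_{xy\in E}c_{xy}\big(f(\eta^{xy})-f(\eta)\big)$ (a bounded operator on $C(\Delta)$). Here $\eta^{xy}(x)=\frac{\pi(x)}{\pi(x)+\pi(y)}(\eta(x)+\eta(y))$, $\eta^{xy}(y)=\frac{\pi(y)}{\pi(x)+\pi(y)}(\eta(x)+\eta(y))$, and $\eta^{xy}(z)=\eta(z)$ for $z\ne x,y$. Write $\mathbb E_\eta$ for expectation when $\eta_0=\eta$. **Assumptions.** 1. (Finite-dimensional geometry.) There are positive sequences $d,t_{\rm Nash},T$ such that, for every $j$ and every $\psi:V\to\mathbb R$, $$\|\psi\|_2^{2(1+2/d)}\le t_{\rm Nash}\big(\mathcal E(\psi)+T^{-1}\|\psi\|_2^2\big)\|\psi\|_1^{4/d},$$ and $d=O(1)$, $t_{\rm Nash}=O(t_{\rm rel})$, $T=\Theta(t_{\rm Nash})$ as $j\to\infty$. 2. (Uniform ellipticity.) There is $c_{\rm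 ell}\in[1,\infty)$ with $\max_x\pi(x)/\min_y\pi(y)\le c_{\rm ell}$ for all $j$. **Proposition (Pre-cutoff).** For every $\delta\in(0,1)$ there is $C>0$, depending only on $\delta$ and on the sequence of graphs and site-weights, such that the following holds for every sequence of natural numbers $k=k_j$ with $k/n^2\to\infty$. Put $$a=2\,\frac{\log(k/n)}{\log k},\qquad T^+=a\,\frac{t_{\rm rel}}2\log k+C\,t_{\rm rel},\qquad T^-=\frac{t_{\rm rel}}2\log k-C\,t_{\rm rel}.$$ Then, for all sufficiently large $j$, $a\in[1,2]$ and $T^\pm\ge0$; and for all $p\in[1,2]$, $$\limsup_{j\to\infty}\sqrt k\,\sup_{\eta\in\Delta}\mathbb E_\eta\Big[\Big\|\frac{\eta_{T^+}}\pi-1\Big\|_p\Big]\le\delta,\qquad \liminf_{j\to\infty}\sqrt k\,\sup_{\eta\in\Delta}\mathbb E_\eta\Big[\Big\|\frac{\eta_{T^-}}\pi-1\Big\|_p\Big]\ge\frac1\delta.$$ -/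

import Mathlib

open Filter Topology MeasureTheory Asymptotics
open scoped ENNReal NNReal CompactlySupported

namespace Averaging

/-- A finite, weighted, connected and undirected graph on the vertex set `V`:
the conductance `c x y` is positive on edges and is set to zero off the edges. -/
structure WeightedGraph (V : Type*) where
  graph : SimpleGraph V
  connected : graph.Connected
  c : V → V → ℝ
  c_symm : ∀ x y, c x y = c y x
  c_pos : ∀ x y, graph.Adj x y → 0 < c x y
  c_zero : ∀ x y, ¬ graph.Adj x y → c x y = 0

/-- Non-degenerate site-weights: a probability on `V` charging every vertex. -/
structure SiteWeights (V : Type*) [Fintype V] where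
  w : V → ℝ
  pos : ∀ x, 0 < w x
  sum_eq_one : ∑ x, w x = 1

theorem WeightedGraph.c_nonneg {V : Type*} (G : WeightedGraph V) (x y : V) : 0 ≤ G.c x y := by
  by_cases h : G.graph.Adj x y
  · exact (G.c_pos x y h).le
  · exact (G.c_zero x y h).ge

noncomputable section

variable {V : Type*} [Fintype V]

/-- The weighted sum `∑_{xy ∈ E} c_{xy} F(x,y)` over unordered edges, for a symmetric `F`
(each edge appears twice in the double sum, hence the factor `1/2`). -/
def WeightedGraph.edgeSum {M : Type*} [AddCommGroup M] [Module ℝ M]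
    (G : WeightedGraph V) (F : V → V → M) : M :=
  (1 / 2 : ℝ) • ∑ x, ∑ y, G.c x y • F x y

/-- The norm of `L^p(V, π)`, for `1 ≤ p < ∞`. -/
def SiteWeights.norm (π : SiteWeights V) (p : ℝ) (ψ : V → ℝ) : ℝ :=
  (∑ x, π.w x * |ψ x| ^ p) ^ (1 / p)

/-! ### The single-particle system -/

open Classical in
/-- Resampling of one particle on the pair `{x, y}`: if it sits at `x` or `y` it is put at `x`
with probability `π(x)/(π(x)+π(y))` and at `y` otherwise. -/
def pairResample (π : SiteWeights V) (x y : V) (f : V → ℝ) : V → ℝ := fun z =>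
  if z = x ∨ z = y then
    π.w x / (π.w x + π.w y) * f x + π.w y / (π.w x + π.w y) * f y
  else f z

/-- The generator of the one-particle Binomial Splitting process. -/
def singleGenerator (G : WeightedGraph V) (π : SiteWeights V) (f : V → ℝ) : V → ℝ := fun z =>
  G.edgeSum fun x y => pairResample π x y f z - f z

/-- The spectral gap of the one-particle system, as the infimum of the Rayleigh quotients. -/
def spectralGap (G : WeightedGraph V) (π : SiteWeights V) : ℝ :=
  sInf {r : ℝ | ∃ f : V → ℝ, f ≠ 0 ∧ ∑ x, π.w x * f x = 0 ∧
    r = (∑ x, π.w x * (f x * -singleGenerator G π f x)) / ∑ x, π.w x * f x ^ 2}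

/-- The relaxation time. -/
def relaxationTime (G : WeightedGraph V) (π : SiteWeights V) : ℝ :=
  (spectralGap G π)⁻¹

/-- The Dirichlet form of the one-particle system. -/
def dirichletForm (G : WeightedGraph V) (π : SiteWeights V) (ψ : V → ℝ) : ℝ :=
  G.edgeSum fun x y => π.w x * π.w y / (π.w x + π.w y) * (ψ x - ψ y) ^ 2

/-- The Nash inequality with constants `d`, `tNash`, `T`. -/
def NashInequality (G : WeightedGraph V) (π : SiteWeights V) (d tNash T : ℝ) : Prop :=
  ∀ ψ : V → ℝ, π.norm 2 ψ ^ (2 * (1 + 2 / d)) ≤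
    tNash * (dirichletForm G π ψ + T⁻¹ * π.norm 2 ψ ^ 2) * π.norm 1 ψ ^ (4 / d)

/-! ### The Averaging process -/

open Classical in
/-- The configuration `η^{xy}` as a function on `V`. -/
def averageFun (π : SiteWeights V) (x y : V) (η : V → ℝ) : V → ℝ := fun z =>
  if z = x then π.w x / (π.w x + π.w y) * (η x + η y)
  else if z = y then π.w y / (π.w x + π.w y) * (η x + η y)
  else η z

theorem averageFun_mem (π : SiteWeights V) (x y : V) {η : V → ℝ} (hη : η ∈ stdSimplex ℝ V) :
    averageFun π x y η ∈ stdSimplex ℝ V := by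
  classical
  have hx := π.pos x
  have hy := π.pos y
  refine ⟨fun z => ?_, ?_⟩
  · have h1 := hη.1 x
    have h2 := hη.1 y
    have h3 := hη.1 z
    unfold averageFun
    split_ifs <;> positivity
  · by_cases hxy : x = y
    · subst hxy
      rw [← hη.2]
      refine Finset.sum_congr rfl fun z _ => ?_
      unfold averageFun
      split_ifs with h
      · subst h
        field_simp
      · rfl
    · have key : ∀ z, averageFun π x y η z = η z
          + (if z = x then π.w x / (π.w x + π.w y) * (η x + η y) - η x else 0)
          + (if z = y then π.w y / (π.w x + π.w y) * (η x + η y) - η y else 0) := by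
        intro z
        unfold averageFun
        by_cases h1 : z = x
        · subst h1
          simp [hxy]
        · by_cases h2 : z = y
          · subst h2
            simp [h1]
          · simp [h1, h2]
      simp only [key, Finset.sum_add_distrib, Finset.sum_ite_eq', Finset.mem_univ, if_true, hη.2]
      field_simp
      ring

/-- The map `η ↦ η^{xy}` on the simplex `Δ` of probability distributions over `V`. -/
def averageMap (π : SiteWeights V) (x y : V) : C(stdSimplex ℝ V, stdSimplex ℝ V) where
  toFun η := ⟨averageFun π x y η.1, averageFun_mem π x y η.2⟩
  continuous_toFun := by
    refine Continuous.subtype_mk (continuous_pi fun z => ?_) _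
    have h : ∀ w, Continuous fun η : stdSimplex ℝ V => η.1 w := fun w =>
      (continuous_apply w).comp continuous_subtype_val
    unfold averageFun
    split_ifs
    · exact continuous_const.mul ((h x).add (h y))
    · exact continuous_const.mul ((h x).add (h y))
    · exact h z

/-- The operator `P_{xy} f (η) = f (η^{xy})` on `C(Δ)`. -/
def averageOp (π : SiteWeights V) (x y : V) :
    C(stdSimplex ℝ V, ℝ) →L[ℝ] C(stdSimplex ℝ V, ℝ) :=
  ContinuousMap.compCLM ℝ ℝ (averageMap π x y)

/-- The generator of the Averaging process, a bounded operator on `C(Δ)`. -/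
def generator (G : WeightedGraph V) (π : SiteWeights V) :
    C(stdSimplex ℝ V, ℝ) →L[ℝ] C(stdSimplex ℝ V, ℝ) :=
  G.edgeSum fun x y => averageOp π x y - 1

/-- The topology of `C(X, ℝ) →L[ℝ] C(X, ℝ)` is that of the operator norm, so that
the exponential below is the one of a Banach algebra. -/
instance isTopologicalRing_clm (X : Type*) [TopologicalSpace X] [CompactSpace X] :
    IsTopologicalRing (C(X, ℝ) →L[ℝ] C(X, ℝ)) :=
  let h : NormedRing (C(X, ℝ) →L[ℝ] C(X, ℝ)) := inferInstance
  inferInstanceAs (@IsTopologicalRing (C(X, ℝ) →L[ℝ] C(X, ℝ))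
    h.toMetricSpace.toPseudoMetricSpace.toUniformSpace.toTopologicalSpace _)

/-- The Markov semigroup `S_t = exp (t L)` of the Averaging process on `C(Δ)`. -/
def semigroup (G : WeightedGraph V) (π : SiteWeights V) (t : ℝ≥0) :
    C(stdSimplex ℝ V, ℝ) →L[ℝ] C(stdSimplex ℝ V, ℝ) :=
  NormedSpace.exp ((t : ℝ) • generator G π)

/-- The positive part of the generator, `∑_{xy ∈ E} c_{xy} P_{xy}`. -/
def jumpOp (G : WeightedGraph V) (π : SiteWeights V) :
    C(stdSimplex ℝ V, ℝ) →L[ℝ] C(stdSimplex ℝ V, ℝ) :=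
  G.edgeSum fun x y => averageOp π x y

theorem jumpOp_apply (G : WeightedGraph V) (π : SiteWeights V) (f : C(stdSimplex ℝ V, ℝ))
    (η : stdSimplex ℝ V) :
    jumpOp G π f η = (1 / 2 : ℝ) * ∑ x, ∑ y, G.c x y * f (averageMap π x y η) := by
  simp [jumpOp, WeightedGraph.edgeSum, averageOp]

theorem pow_apply_nonneg {X : Type*} [TopologicalSpace X] (A : C(X, ℝ) →L[ℝ] C(X, ℝ))
    (hA : ∀ f : C(X, ℝ), (∀ x, 0 ≤ f x) → ∀ x, 0 ≤ A f x) (n : ℕ) :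
    ∀ f : C(X, ℝ), (∀ x, 0 ≤ f x) → ∀ x, 0 ≤ (A ^ n) f x := by
  induction n with
  | zero => intro f hf x; simpa using hf x
  | succ n ih =>
    intro f hf x
    rw [pow_succ, mul_apply_eq_comp]
    exact ih _ (hA f hf) x

theorem smul_jumpOp_nonneg (G : WeightedGraph V) (π : SiteWeights V) (t : ℝ≥0)
    (f : C(stdSimplex ℝ V, ℝ)) (hf : ∀ η, 0 ≤ f η) (η : stdSimplex ℝ V) :
    0 ≤ ((t : ℝ) • jumpOp G π) f η := by
  rw [smul_apply, ContinuousMap.smul_apply, jumpOp_apply, smul_eq_mul]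
  exact mul_nonneg t.2 (mul_nonneg (by norm_num) (Finset.sum_nonneg fun x _ =>
    Finset.sum_nonneg fun y _ => mul_nonneg (G.c_nonneg x y) (hf _)))

theorem generator_eq (G : WeightedGraph V) (π : SiteWeights V) :
    generator G π = jumpOp G π - algebraMap ℝ _ (G.edgeSum fun _ _ => (1 : ℝ)) := by
  ext f η
  simp [generator, jumpOp, WeightedGraph.edgeSum, Algebra.algebraMap_eq_smul_one,
    mul_sub, Finset.sum_sub_distrib,
    ← Finset.sum_mul]
  ring

theorem exp_algebraMap_add {A : Type*} [NormedRing A] [NormedAlgebra ℝ A] [CompleteSpace A]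
    (r : ℝ) (a : A) :
    NormedSpace.exp (algebraMap ℝ A r + a) = Real.exp r • NormedSpace.exp a := by
  let _ : NormedAlgebra ℚ A := NormedAlgebra.restrictScalars ℚ ℝ A
  rw [NormedSpace.exp_add_of_commute (Algebra.commutes _ _), ← NormedSpace.algebraMap_exp_comm,
    ← Real.exp_eq_exp_ℝ, Algebra.smul_def]

theorem semigroup_nonneg (G : WeightedGraph V) (π : SiteWeights V) (t : ℝ≥0)
    (f : C(stdSimplex ℝ V, ℝ)) (hf : ∀ η, 0 ≤ f η) (η : stdSimplex ℝ V) :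
    0 ≤ semigroup G π t f η := by
  set r : ℝ := G.edgeSum fun _ _ => (1 : ℝ) with hr
  have h1 : (t : ℝ) • generator G π = algebraMap ℝ _ (-((t : ℝ) * r)) + (t : ℝ) • jumpOp G π := by
    rw [generator_eq, ← hr, smul_sub, Algebra.algebraMap_eq_smul_one,
      Algebra.algebraMap_eq_smul_one, smul_smul, neg_smul]
    abel
  have h2 : semigroup G π t
      = Real.exp (-((t : ℝ) * r)) • NormedSpace.exp ((t : ℝ) • jumpOp G π) := by
    rw [semigroup, h1]
    exact exp_algebraMap_add (A := C(stdSimplex ℝ V, ℝ) →L[ℝ] C(stdSimplex ℝ V, ℝ)) _ _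
  have h3 := NormedSpace.exp_series_hasSum_exp' (𝕂 := ℝ) ((t : ℝ) • jumpOp G π)
  have h4 := h3.mapL (ContinuousLinearMap.apply ℝ (C(stdSimplex ℝ V, ℝ)) f)
  have h5 := h4.mapL (ContinuousMap.evalCLM ℝ η)
  have h6 : 0 ≤ NormedSpace.exp ((t : ℝ) • jumpOp G π) f η := by
    refine h5.nonneg fun n => ?_
    have := pow_apply_nonneg _ (smul_jumpOp_nonneg G π t) n f hf η
    simp only [ContinuousLinearMap.apply_apply, ContinuousMap.evalCLM_apply,
      smul_apply, ContinuousMap.smul_apply, smul_eq_mul]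
    positivity
  rw [h2]
  simp only [smul_apply, ContinuousMap.smul_apply, smul_eq_mul]
  exact mul_nonneg (Real.exp_pos _).le h6

/-- The positive linear functional `f ↦ (S_t f)(η)`. -/
def semigroupFunctional (G : WeightedGraph V) (π : SiteWeights V) (t : ℝ≥0)
    (η : stdSimplex ℝ V) : C_c(stdSimplex ℝ V, ℝ) →ₚ[ℝ] ℝ :=
  PositiveLinearMap.mk₀
    { toFun := fun f => semigroup G π t f.toContinuousMap η
      map_add' := fun f g => by
        have : (f + g).toContinuousMap = f.toContinuousMap + g.toContinuousMap := rfl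
        rw [this, map_add]; rfl
      map_smul' := fun a f => by
        have : (a • f).toContinuousMap = a • f.toContinuousMap := rfl
        rw [this, map_smul]; rfl }
    (fun f hf => semigroup_nonneg G π t f.toContinuousMap hf η)

/-- The law of `η_t` for the Averaging process started from `η`: the measure on `Δ` which
represents the functional `f ↦ (S_t f)(η)`. -/
def law (G : WeightedGraph V) (π : SiteWeights V) (t : ℝ≥0) (η : stdSimplex ℝ V) :
    Measure (stdSimplex ℝ V) :=
  RealRMK.rieszMeasure (semigroupFunctional G π t η)

theorem integral_law (G : WeightedGraph V) (π : SiteWeights V) (t : ℝ≥0) (η : stdSimplex ℝ V)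
    (f : C(stdSimplex ℝ V, ℝ)) : ∫ ζ, f ζ ∂(law G π t η) = semigroup G π t f η :=
  RealRMK.integral_rieszMeasure (semigroupFunctional G π t η)
    (CompactlySupportedContinuousMap.continuousMapEquiv f)

theorem semigroup_one (G : WeightedGraph V) (π : SiteWeights V) (t : ℝ≥0) :
    semigroup G π t 1 = 1 := by
  have h0 : ((t : ℝ) • generator G π) 1 = 0 := by
    ext η
    simp [generator, WeightedGraph.edgeSum, averageOp]
  have h3 := (NormedSpace.exp_series_hasSum_exp' (𝕂 := ℝ) ((t : ℝ) • generator G π)).mapL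
    (ContinuousLinearMap.apply ℝ (C(stdSimplex ℝ V, ℝ)) 1)
  change ContinuousLinearMap.apply ℝ (C(stdSimplex ℝ V, ℝ)) 1 (NormedSpace.exp _) = 1
  refine h3.unique ?_
  have h4 := hasSum_single (f := fun n : ℕ => ContinuousLinearMap.apply ℝ (C(stdSimplex ℝ V, ℝ)) 1
    (((n.factorial : ℝ)⁻¹) • ((t : ℝ) • generator G π) ^ n)) 0 ?_
  · simpa using h4
  · intro n hn
    obtain ⟨m, rfl⟩ := Nat.exists_eq_succ_of_ne_zero hn
    simp only [ContinuousLinearMap.apply_apply, smul_apply, pow_succ,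
      mul_apply_eq_comp, h0, map_zero, smul_zero]

instance isProbabilityMeasure_law (G : WeightedGraph V) (π : SiteWeights V) (t : ℝ≥0)
    (η : stdSimplex ℝ V) : IsProbabilityMeasure (law G π t η) := by
  have : IsFiniteMeasure (law G π t η) := by unfold law; infer_instance
  have h := integral_law G π t η 1
  rw [semigroup_one] at h
  have h' : (law G π t η).real Set.univ = 1 := by simpa using h
  exact ⟨by rwa [Measure.real, ENNReal.toReal_eq_one_iff] at h'⟩

/-- The expected `L^p` distance to equilibrium `E_η[‖η_t/π - 1‖_p]`. -/
def expectedDist (G : WeightedGraph V) (π : SiteWeights V) (p : ℝ) (t : ℝ≥0)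
    (η : stdSimplex ℝ V) : ℝ≥0∞ :=
  ∫⁻ ζ, ENNReal.ofReal (π.norm p fun x => ζ x / π.w x - 1) ∂(law G π t η)

/-- The worst-case distance `sup_{η ∈ Δ} E_η[‖η_t/π - 1‖_p]`. -/
def worstDist (G : WeightedGraph V) (π : SiteWeights V) (p : ℝ) (t : ℝ≥0) : ℝ≥0∞ :=
  ⨆ η : stdSimplex ℝ V, expectedDist G π p t η

end

/-! ### Assumptions on sequences of graphs and site-weights -/

/-- Finite-dimensional geometries: good Nash inequalities along the sequence. -/
def FiniteDimensional {V : ℕ → Type*} [∀ j, Fintype (V j)]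
    (G : ∀ j, WeightedGraph (V j)) (π : ∀ j, SiteWeights (V j)) : Prop :=
  ∃ d tNash T : ℕ → ℝ,
    (∀ j, 0 < d j ∧ 0 < tNash j ∧ 0 < T j) ∧
    (∀ j, NashInequality (G j) (π j) (d j) (tNash j) (T j)) ∧
    d =O[atTop] (fun _ => (1 : ℝ)) ∧
    tNash =O[atTop] (fun j => relaxationTime (G j) (π j)) ∧
    T =Θ[atTop] tNash

/-- Uniformly elliptic site-weights. -/
def UniformlyElliptic {V : ℕ → Type*} [∀ j, Fintype (V j)]
    (π : ∀ j, SiteWeights (V j)) : Prop :=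
  ∃ cEll : ℝ, 1 ≤ cEll ∧ ∀ j, (⨆ x, (π j).w x) / (⨅ y, (π j).w y) ≤ cEll

/-- The factor `a = 2 log(k/n) / log k`. -/
noncomputable def preCutoffFactor (n k : ℕ) : ℝ :=
  2 * (Real.log ((k : ℝ) / n) / Real.log k)

/-- `T⁺ = a (t_rel/2) log k + C t_rel`. -/
noncomputable def timePlus (tRel C : ℝ) (n k : ℕ) : ℝ :=
  preCutoffFactor n k * (tRel / 2) * Real.log k + C * tRel

/-- `T⁻ = (t_rel/2) log k - C t_rel`. -/
noncomputable def timeMinus (tRel C : ℝ) (k : ℕ) : ℝ :=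
  tRel / 2 * Real.log k - C * tRel

end Averaging

/-!
Let `Q η = ‖η / π - 1‖₂²`. A single averaging step across `xy` lowers `Q` by a multiple of
`(η x / π x - η y / π y)²`, so `E Q(η_t)` decreases at the rate `E 𝓔(η_t / π)`. As `η / π` has
`L¹`-norm one, the Nash inequality turns this into a differential inequality which forces
`E Q(η_t) ≤ M ε^{-ν}` at time `t = ε t_rel`, uniformly in the initial state.

At later times, expand in an eigenbasis of `L`. By Duhamel's formula `E Q(η_t)` is
`‖e^{tL}(η₀ / π - 1)‖₂²`, which decays like `e^{-2t / t_rel}`, plus the integral over `s ≤ t` of the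
noise produced at time `s` and smoothed by `e^{(t-s)L}`. The noise produced in the last `ε t_rel`
units of time is controlled by the decrease of `E Q` alone and costs a factor `1/2`. As
`E Q(η_r) ≥ ‖e^{rL}(η₀ / π - 1)‖₂²`, the short-time bound also applies to `e^{rL}` and to the jumps
smoothed by it: together with the weight `O(1/n)` of an edge, it shows that the earlier noise
contributes `O(ε^{-ν} e^{-t / t_rel} / n)`. Iterating with geometrically decreasing `ε` removes the
remainder, and `E Q(η_t) ≲ e^{-2t / t_rel} + e^{-t / t_rel} / n`. For `k ≥ n²` both terms have
dropped to `1 / k` at `t = t_rel log (k / n)`, which is `a (t_rel / 2) log k`.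

In the other direction, a gap eigenfunction, tested against the process started from the vertex
where it is largest in absolute value, shows that the expected `L¹` distance is at least
`e^{-t / t_rel}`, which exceeds `1 / √k` until `t = (t_rel / 2) log k`.
-/

namespace Averaging

/-! ### Differential and recursive inequalities -/

theorem sub_le_sub_of_hasDerivAt_le {φ ψ φ' ψ' : ℝ → ℝ} {a b : ℝ} (hab : a ≤ b)
    (hφ : ∀ x ∈ Set.Icc a b, HasDerivAt φ (φ' x) x) (hψ : ∀ x ∈ Set.Icc a b, HasDerivAt ψ (ψ' x) x)
    (h : ∀ x ∈ Set.Icc a b, φ' x ≤ ψ' x) : φ b - φ a ≤ ψ b - ψ a := by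
  have hderiv : ∀ x ∈ Set.Icc a b, HasDerivAt (ψ - φ) (ψ' x - φ' x) x :=
    fun x hx => (hψ x hx).sub (hφ x hx)
  have hmono : MonotoneOn (ψ - φ) (Set.Icc a b) := by
    refine monotoneOn_of_deriv_nonneg (convex_Icc a b)
      (fun x hx => (hderiv x hx).continuousAt.continuousWithinAt)
      (fun x hx => (hderiv x (interior_subset hx)).differentiableAt.differentiableWithinAt)
      fun x hx => ?_
    rw [(hderiv x (interior_subset hx)).deriv]
    exact sub_nonneg.2 (h x (interior_subset hx))
  have := hmono (Set.left_mem_Icc.2 hab) (Set.right_mem_Icc.2 hab) hab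
  simp only [Pi.sub_apply] at this
  linarith

theorem le_rpow_of_rpow_le_deriv {y D : ℝ → ℝ} {a ν t : ℝ} (ha : 0 < a) (hν : 0 < ν) (ht : 0 < t)
    (hy : ∀ s ∈ Set.Icc 0 t, 0 < y s) (hderiv : ∀ s ∈ Set.Icc 0 t, HasDerivAt y (-D s) s)
    (h : ∀ s ∈ Set.Icc 0 t, y s ^ (1 + 1 / ν) ≤ a * D s) : y t ≤ (a * ν / t) ^ ν := by
  have hmem : t ∈ Set.Icc 0 t := Set.right_mem_Icc.2 ht.le
  have hgrowth : t / (a * ν) ≤ y t ^ (-(1 / ν)) := by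
    have hpow : ∀ s ∈ Set.Icc 0 t, HasDerivAt (fun s => y s ^ (-(1 / ν)))
        (-D s * (-(1 / ν)) * y s ^ (-(1 / ν) - 1)) s :=
      fun s hs => (hderiv s hs).rpow_const (Or.inl (hy s hs).ne')
    have hlin : ∀ s ∈ Set.Icc 0 t, HasDerivAt (fun s => s / (a * ν)) (1 / (a * ν)) s :=
      fun s _ => (hasDerivAt_id s).div_const _
    have hle := sub_le_sub_of_hasDerivAt_le ht.le hlin hpow fun s hs => by
      have hinv : y s ^ (-(1 / ν) - 1) = (y s ^ (1 + 1 / ν))⁻¹ := by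
        rw [← Real.rpow_neg (hy s hs).le]
        congr 1
        ring
      have hpos := Real.rpow_pos_of_pos (hy s hs) (1 + 1 / ν)
      rw [hinv, ← div_eq_mul_inv, div_le_div_iff₀ (by positivity) hpos]
      calc 1 * y s ^ (1 + 1 / ν) ≤ a * D s := by simpa using h s hs
        _ = -D s * -(1 / ν) * (a * ν) := by field_simp
    have hzero := Real.rpow_nonneg (hy 0 (Set.left_mem_Icc.2 ht.le)).le (-(1 / ν))
    simp only [zero_div] at hle
    linarith
  calc y t = (y t ^ (-(1 / ν))) ^ (-ν) := by
        rw [← Real.rpow_mul (hy t hmem).le]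
        simp [hν.ne']
    _ ≤ (t / (a * ν)) ^ (-ν) :=
        Real.rpow_le_rpow_of_nonpos (by positivity) hgrowth (neg_nonpos.2 hν.le)
    _ = (a * ν / t) ^ ν := by
        rw [Real.rpow_neg (by positivity), ← Real.inv_rpow (by positivity), inv_div]

theorem le_rpow_add_rpow_of_nash {y D : ℝ → ℝ} {a b ν t : ℝ} (ha : 0 < a) (hb : 0 ≤ b)
    (hν : 0 < ν) (ht : 0 < t) (hy : ∀ s ∈ Set.Icc 0 t, 0 < y s)
    (hD : ∀ s ∈ Set.Icc 0 t, 0 ≤ D s) (hderiv : ∀ s ∈ Set.Icc 0 t, HasDerivAt y (-D s) s)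
    (h : ∀ s ∈ Set.Icc 0 t, y s ^ (1 + 1 / ν) ≤ a * D s + b * y s) :
    y t ≤ (2 * b) ^ ν + (2 * a * ν / t) ^ ν := by
  rcases le_total (y t) ((2 * b) ^ ν) with hsmall | hlarge
  · exact hsmall.trans (le_add_of_nonneg_right (by positivity))
  have habsorb : ∀ s ∈ Set.Icc 0 t, y s ^ (1 + 1 / ν) ≤ 2 * a * D s := fun s hs => by
    have hanti : y t ≤ y s := by
      have hsub : ∀ r ∈ Set.Icc s t, r ∈ Set.Icc 0 t := fun r hr => ⟨hs.1.trans hr.1, hr.2⟩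
      have := sub_le_sub_of_hasDerivAt_le hs.2 (fun r hr => hderiv r (hsub r hr))
        (fun r _ => hasDerivAt_const r (0 : ℝ)) fun r hr => neg_nonpos.2 (hD r (hsub r hr))
      linarith
    have hroot : 2 * b ≤ y s ^ (1 / ν) := by
      have := Real.rpow_le_rpow (by positivity) (hlarge.trans hanti) (one_div_nonneg.2 hν.le)
      rwa [one_div, Real.rpow_rpow_inv (by positivity) hν.ne', ← one_div] at this
    have hy_s := hy s hs
    have hmul := mul_le_mul_of_nonneg_right hroot hy_s.le
    have hnash := h s hs
    rw [Real.rpow_add hy_s, Real.rpow_one] at hnash ⊢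
    linarith
  exact (le_rpow_of_rpow_le_deriv (mul_pos two_pos ha) hν ht hy hderiv habsorb).trans
    (le_add_of_nonneg_left (by positivity))

theorem nonpos_of_le_half_succ {w : ℕ → ℝ} {K : ℝ} (hK : ∀ i, w i ≤ K)
    (h : ∀ i, w i ≤ 1 / 2 * w (i + 1)) : w 0 ≤ 0 := by
  have hiter : ∀ n, w 0 ≤ (1 / 2) ^ n * w n := by
    intro n
    induction n with
    | zero => simp
    | succ n ih =>
      calc w 0 ≤ (1 / 2) ^ n * w n := ih
        _ ≤ (1 / 2) ^ n * (1 / 2 * w (n + 1)) := by gcongr; exact h n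
        _ = (1 / 2) ^ (n + 1) * w (n + 1) := by ring
  have hlim : Tendsto (fun n : ℕ => (1 / 2 : ℝ) ^ n * K) atTop (𝓝 0) := by
    simpa using (tendsto_pow_atTop_nhds_zero_of_lt_one (by norm_num : (0 : ℝ) ≤ 1 / 2)
      (by norm_num)).mul_const K
  exact ge_of_tendsto' hlim fun n => (hiter n).trans (by gcongr; exact hK n)

theorem pow_rpow_neg_le {ν : ℝ} (hν : 1 ≤ ν) (i : ℕ) :
    ((1 - 1 / (4 * ν)) ^ i) ^ (-ν) ≤ (4 / 3) ^ i := by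
  have : 0 < ν := by linarith
  have hsmall : 1 / (4 * ν) ≤ 1 / 4 := one_div_le_one_div_of_le (by norm_num) (by linarith)
  have hbernoulli : 3 / 4 ≤ (1 - 1 / (4 * ν)) ^ ν := by
    have := one_add_mul_self_le_rpow_one_add (s := -(1 / (4 * ν))) (by linarith) hν
    calc (3 / 4 : ℝ) = 1 + ν * -(1 / (4 * ν)) := by field_simp; norm_num
      _ ≤ (1 - 1 / (4 * ν)) ^ ν := by simpa only [sub_eq_add_neg] using this
  have hnonneg : 0 ≤ 1 - 1 / (4 * ν) := by linarith
  rw [Real.rpow_neg (by positivity), ← Real.rpow_pow_comm hnonneg, ← inv_pow]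
  gcongr
  calc ((1 - 1 / (4 * ν)) ^ ν)⁻¹ ≤ (3 / 4)⁻¹ := inv_anti₀ (by norm_num) hbernoulli
    _ = 4 / 3 := by norm_num

/- The inequality is iterated along `t + 4 ν ρ ^ i` with `ρ = 1 - 1 / (4 ν)`: the lag at step `i` is
`ρ ^ i`, and its singular term `B ρ ^ (-ν i) ≤ B (4 / 3) ^ i` is beaten by the factors `1 / 2`. -/
theorem le_of_half_contraction {v : ℝ → ℝ} {t ν A B K : ℝ} (hν : 1 ≤ ν) (hB : 0 ≤ B)
    (hK : ∀ s, t ≤ s → v s ≤ K)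
    (h : ∀ s, ∀ e ∈ Set.Ioc (0 : ℝ) 1, t ≤ s - e →
      v s ≤ 1 / 2 * v (s - e) + 1 / 2 * (A + B * e ^ (-ν))) :
    v (t + 4 * ν) ≤ A + 3 / 2 * B := by
  have : 0 < ν := by linarith
  set ρ : ℝ := 1 - 1 / (4 * ν) with hρ
  have hρ0 : 0 < ρ := by
    have : 1 / (4 * ν) ≤ 1 / 4 := one_div_le_one_div_of_le (by norm_num) (by linarith)
    linarith
  have hρ1 : ρ ≤ 1 := sub_le_self _ (by positivity)
  have hlag : ∀ i : ℕ, t + 4 * ν * ρ ^ i - ρ ^ i = t + 4 * ν * ρ ^ (i + 1) := fun i => by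
    rw [pow_succ, hρ]
    field_simp
    ring
  have hzero := nonpos_of_le_half_succ
    (w := fun i => v (t + 4 * ν * ρ ^ i) - A - 3 / 2 * B * (4 / 3) ^ i) (K := K - A)
    (fun i => by
      have := hK (t + 4 * ν * ρ ^ i) (le_add_of_nonneg_right (by positivity))
      have : 0 ≤ 3 / 2 * B * (4 / 3) ^ i := by positivity
      linarith)
    fun i => by
      have hstep := h (t + 4 * ν * ρ ^ i) (ρ ^ i) ⟨by positivity, pow_le_one₀ hρ0.le hρ1⟩
        (by rw [hlag]; exact le_add_of_nonneg_right (by positivity))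
      rw [hlag] at hstep
      have hsing := mul_le_mul_of_nonneg_left (pow_rpow_neg_le hν i) hB
      rw [pow_succ (4 / 3 : ℝ)]
      linarith
  simp only [pow_zero, mul_one] at hzero
  linarith

/-! ### The spectral theorem for an inner product which is not registered as an instance -/

theorem exists_eigenbasis_of_core {E : Type*} [AddCommGroup E] [Module ℝ E]
    [Module.Finite ℝ E] {n : ℕ} (hn : Module.finrank ℝ E = n) (c : InnerProductSpace.Core ℝ E)
    {A : E →ₗ[ℝ] E} (hA : ∀ f g, c.inner (A f) g = c.inner f (A g)) :
    ∃ (lam : Fin n → ℝ) (b : Fin n → E),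
      (∀ i, A (b i) = lam i • b i) ∧ (∀ i, c.inner (b i) (b i) = 1) ∧
      ∀ f g, ∑ i, c.inner f (b i) * c.inner (b i) g = c.inner f g := by
  let _ := c.toNormedAddCommGroup
  let _ := InnerProductSpace.ofCore c.toCore
  have hsymm : A.IsSymmetric := hA
  refine ⟨hsymm.eigenvalues hn, hsymm.eigenvectorBasis hn,
    fun i => hsymm.apply_eigenvectorBasis hn i, fun i => ?_,
    fun f g => (hsymm.eigenvectorBasis hn).sum_inner_mul_inner f g⟩
  have hnorm := (hsymm.eigenvectorBasis hn).orthonormal.norm_eq_one i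
  rw [← one_pow 2, ← hnorm]
  exact real_inner_self_eq_norm_sq _

noncomputable section

variable {V : Type*} [Fintype V]

/-! ### Sums over edges -/

namespace WeightedGraph

variable (G : WeightedGraph V) {M N : Type*} [AddCommGroup M] [Module ℝ M]
  [AddCommGroup N] [Module ℝ N]

theorem map_edgeSum (φ : M →ₗ[ℝ] N) (F : V → V → M) :
    φ (G.edgeSum F) = G.edgeSum fun x y => φ (F x y) := by
  simp only [edgeSum, map_smul, map_sum]

theorem edgeSum_add (F H : V → V → M) :
    (G.edgeSum fun x y => F x y + H x y) = G.edgeSum F + G.edgeSum H := by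
  simp only [edgeSum, smul_add, Finset.sum_add_distrib]

theorem edgeSum_neg (F : V → V → M) : (G.edgeSum fun x y => -F x y) = -G.edgeSum F :=
  (G.map_edgeSum (-LinearMap.id) F).symm

theorem edgeSum_smul (a : ℝ) (F : V → V → M) :
    (G.edgeSum fun x y => a • F x y) = a • G.edgeSum F :=
  (G.map_edgeSum (LinearMap.lsmul ℝ M a) F).symm

theorem edgeSum_apply {ι : Type*} (F : V → V → ι → ℝ) (z : ι) :
    G.edgeSum F z = G.edgeSum fun x y => F x y z :=
  G.map_edgeSum (LinearMap.proj z) F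

theorem edgeSum_le_edgeSum {F H : V → V → ℝ} (h : ∀ x y, F x y ≤ H x y) :
    G.edgeSum F ≤ G.edgeSum H :=
  smul_le_smul_of_nonneg_left (Finset.sum_le_sum fun x _ => Finset.sum_le_sum fun y _ =>
    mul_le_mul_of_nonneg_left (h x y) (G.c_nonneg x y)) (by norm_num)

theorem edgeSum_nonneg {F : V → V → ℝ} (h : ∀ x y, 0 ≤ F x y) : 0 ≤ G.edgeSum F := by
  simpa [edgeSum] using G.edgeSum_le_edgeSum h

theorem eq_zero_of_edgeSum_eq_zero {F : V → V → ℝ} (hF : ∀ x y, 0 ≤ F x y)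
    (h : G.edgeSum F = 0) {x y : V} (hxy : G.graph.Adj x y) : F x y = 0 := by
  have hterm : ∀ x y, 0 ≤ G.c x y * F x y := fun x y => mul_nonneg (G.c_nonneg x y) (hF x y)
  have hsum : ∑ x, ∑ y, G.c x y * F x y = 0 := by simpa [edgeSum] using h
  have hrow := (Finset.sum_eq_zero_iff_of_nonneg fun x _ =>
    Finset.sum_nonneg fun y _ => hterm x y).1 hsum x (Finset.mem_univ x)
  have hxy_term := (Finset.sum_eq_zero_iff_of_nonneg fun y _ => hterm x y).1 hrow y
    (Finset.mem_univ y)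
  exact (mul_eq_zero.1 hxy_term).resolve_left (G.c_pos x y hxy).ne'

end WeightedGraph

/-! ### The single-particle system -/

/-- The inner product of `L²(V, π)`. -/
def SiteWeights.inner (π : SiteWeights V) : LinearMap.BilinForm ℝ (V → ℝ) :=
  LinearMap.mk₂ ℝ (fun f g => ∑ x, π.w x * (f x * g x))
    (fun f f' g => by simp only [Pi.add_apply, add_mul, mul_add, Finset.sum_add_distrib])
    (fun a f g => by
      simp only [Pi.smul_apply, smul_eq_mul, Finset.mul_sum, mul_assoc, mul_left_comm a])
    (fun f g g' => by simp only [Pi.add_apply, mul_add, Finset.sum_add_distrib])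
    (fun a f g => by simp only [Pi.smul_apply, smul_eq_mul, Finset.mul_sum, mul_left_comm a])

/-- Half the harmonic mean of `π(x)` and `π(y)`, the weight of the edge `xy` in the
Dirichlet form. -/
def edgeWeight (π : SiteWeights V) (x y : V) : ℝ := π.w x * π.w y / (π.w x + π.w y)

open Classical in
/-- The density `1_x / π(x)` with respect to `π` of the point mass at `x`. -/
def diracDensity (π : SiteWeights V) (x : V) : V → ℝ := Pi.single x (π.w x)⁻¹

/-- The difference `1_x / π(x) - 1_y / π(y)`, along which resampling the pair `{x, y}` moves. -/
def dipole (π : SiteWeights V) (x y : V) : V → ℝ := diracDensity π x - diracDensity π y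

/-- A function on `V` of mean zero with respect to `π`. -/
def MeanZero (π : SiteWeights V) (f : V → ℝ) : Prop := ∑ x, π.w x * f x = 0

section SiteWeights

variable (π : SiteWeights V)

theorem inner_apply (f g : V → ℝ) : π.inner f g = ∑ x, π.w x * (f x * g x) := rfl

theorem inner_comm (f g : V → ℝ) : π.inner f g = π.inner g f := by
  simp only [inner_apply, mul_comm (f _)]

theorem inner_self_nonneg (f : V → ℝ) : 0 ≤ π.inner f f :=
  Finset.sum_nonneg fun x _ => mul_nonneg (π.pos x).le (mul_self_nonneg _)

variable {π} in
theorem eq_zero_of_inner_self_eq_zero {f : V → ℝ} (h : π.inner f f = 0) : f = 0 := by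
  funext x
  have := (Finset.sum_eq_zero_iff_of_nonneg fun x _ =>
    mul_nonneg (π.pos x).le (mul_self_nonneg (f x))).1 h x (Finset.mem_univ x)
  simpa [(π.pos x).ne'] using this

variable {π} in
theorem inner_self_pos {f : V → ℝ} (hf : f ≠ 0) : 0 < π.inner f f :=
  (inner_self_nonneg π f).lt_of_ne' fun h => hf (eq_zero_of_inner_self_eq_zero h)

theorem inner_one_left (f : V → ℝ) : π.inner 1 f = ∑ x, π.w x * f x := by
  simp [inner_apply]

theorem inner_one_one : π.inner 1 1 = 1 := by
  simp [inner_one_left, π.sum_eq_one]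

theorem meanZero_iff {f : V → ℝ} : MeanZero π f ↔ π.inner 1 f = 0 := by
  rw [inner_one_left, MeanZero]

theorem inner_diracDensity (x : V) (g : V → ℝ) : π.inner (diracDensity π x) g = g x := by
  classical
  have hx := (π.pos x).ne'
  rw [inner_apply, Finset.sum_eq_single x]
  · simp [diracDensity, hx]
  · intro y _ hy
    simp [diracDensity, hy]
  · simp

theorem inner_dipole (x y : V) (g : V → ℝ) : π.inner (dipole π x y) g = g x - g y := by
  simp [dipole, inner_diracDensity]

theorem meanZero_dipole (x y : V) : MeanZero π (dipole π x y) := by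
  rw [meanZero_iff, inner_comm, inner_dipole]
  simp

theorem edgeWeight_pos (x y : V) : 0 < edgeWeight π x y :=
  div_pos (mul_pos (π.pos x) (π.pos y)) (add_pos (π.pos x) (π.pos y))

theorem edgeWeight_le_left (x y : V) : edgeWeight π x y ≤ π.w x := by
  have hx := π.pos x
  have hy := π.pos y
  rw [edgeWeight, div_le_iff₀ (add_pos hx hy)]
  nlinarith

theorem edgeWeight_mul_inner_dipole {x y : V} (hxy : x ≠ y) :
    edgeWeight π x y * π.inner (dipole π x y) (dipole π x y) = 1 := by
  classical
  have hx := π.pos x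
  have hy := π.pos y
  rw [inner_dipole]
  simp only [dipole, diracDensity, edgeWeight, Pi.sub_apply, Pi.single_eq_same,
    Pi.single_eq_of_ne hxy, Pi.single_eq_of_ne hxy.symm]
  field_simp
  ring

theorem edgeWeight_mul_inner_dipole_le_one (x y : V) :
    edgeWeight π x y * π.inner (dipole π x y) (dipole π x y) ≤ 1 := by
  rcases eq_or_ne x y with rfl | hxy
  · simp [dipole]
  · exact (edgeWeight_mul_inner_dipole π hxy).le

theorem pairResample_eq (x y : V) (f : V → ℝ) :
    pairResample π x y f = f - (edgeWeight π x y * (f x - f y)) • dipole π x y := by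
  classical
  have hx := π.pos x
  have hy := π.pos y
  funext z
  simp only [pairResample, dipole, diracDensity, edgeWeight, Pi.sub_apply, Pi.smul_apply,
    smul_eq_mul, Pi.single_apply]
  by_cases hzx : z = x
  · subst hzx
    by_cases hzy : z = y
    · subst hzy
      simp only [or_self, if_true]
      field_simp
      ring
    · simp only [hzy, or_false, if_true, if_false]
      field_simp
      ring
  · by_cases hzy : z = y
    · subst hzy
      simp only [hzx, false_or, if_true, if_false]
      field_simp
      ring
    · simp [hzx, hzy]

end SiteWeights

section SingleParticle

variable (G : WeightedGraph V) (π : SiteWeights V)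

theorem singleGenerator_eq (f : V → ℝ) :
    singleGenerator G π f =
      -G.edgeSum fun x y => (edgeWeight π x y * (f x - f y)) • dipole π x y := by
  funext z
  rw [Pi.neg_apply, WeightedGraph.edgeSum_apply, ← WeightedGraph.edgeSum_neg]
  simp [singleGenerator, pairResample_eq]

/-- The generator of the one-particle system as a linear map. -/
def singleGeneratorLinear : (V → ℝ) →ₗ[ℝ] V → ℝ where
  toFun := singleGenerator G π
  map_add' f g := by
    simp only [singleGenerator_eq, ← neg_add, ← WeightedGraph.edgeSum_add, ← add_smul]
    refine congrArg (fun F => -G.edgeSum F) (funext₂ fun x y => ?_)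
    rw [Pi.add_apply, Pi.add_apply, add_sub_add_comm, mul_add]
  map_smul' a f := by
    simp only [singleGenerator_eq, smul_neg, ← WeightedGraph.edgeSum_smul, RingHom.id_apply,
      smul_smul]
    refine congrArg (fun F => -G.edgeSum F) (funext₂ fun x y => ?_)
    rw [Pi.smul_apply, Pi.smul_apply, ← smul_sub, smul_eq_mul, mul_left_comm]

theorem inner_singleGenerator (f g : V → ℝ) :
    π.inner (singleGenerator G π f) g =
      -G.edgeSum fun x y => edgeWeight π x y * ((f x - f y) * (g x - g y)) := by
  rw [singleGenerator_eq, inner_comm, map_neg, WeightedGraph.map_edgeSum]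
  simp only [map_smul, inner_comm π g, LinearMap.smul_apply, inner_dipole, smul_eq_mul, mul_assoc]

theorem inner_singleGenerator_comm (f g : V → ℝ) :
    π.inner (singleGenerator G π f) g = π.inner f (singleGenerator G π g) := by
  rw [inner_comm π f, inner_singleGenerator, inner_singleGenerator]
  simp only [mul_comm (f _ - f _)]

theorem dirichletForm_eq (f : V → ℝ) :
    dirichletForm G π f = -π.inner (singleGenerator G π f) f := by
  simp only [inner_singleGenerator, neg_neg, ← sq]
  rfl

theorem dirichletForm_nonneg (f : V → ℝ) : 0 ≤ dirichletForm G π f :=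
  G.edgeSum_nonneg fun x y => mul_nonneg (edgeWeight_pos π x y).le (sq_nonneg _)

theorem dirichletForm_add_const (f : V → ℝ) (a : ℝ) :
    dirichletForm G π (fun x => f x + a) = dirichletForm G π f := by
  simp [dirichletForm]

variable {G π} in
theorem eq_of_dirichletForm_eq_zero {f : V → ℝ} (h : dirichletForm G π f = 0) (x y : V) :
    f x = f y := by
  have hadj : ∀ x y, G.graph.Adj x y → f x = f y := fun x y hxy => by
    have hedge := G.eq_zero_of_edgeSum_eq_zero
      (fun x y => mul_nonneg (edgeWeight_pos π x y).le (sq_nonneg (f x - f y))) h hxy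
    have hsq := (mul_eq_zero.1 hedge).resolve_left (edgeWeight_pos π x y).ne'
    exact sub_eq_zero.1 (pow_eq_zero_iff two_ne_zero |>.1 hsq)
  obtain ⟨walk⟩ := G.connected.preconnected x y
  induction walk with
  | nil => rfl
  | cons h _ ih => exact (hadj _ _ h).trans ih

theorem spectralGap_eq :
    spectralGap G π = sInf {r : ℝ | ∃ f : V → ℝ, f ≠ 0 ∧ MeanZero π f ∧
      r = dirichletForm G π f / π.inner f f} := by
  have hform : ∀ f : V → ℝ,
      ∑ x, π.w x * (f x * -singleGenerator G π f x) = dirichletForm G π f := fun f => by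
    rw [dirichletForm_eq, inner_comm, ← map_neg]
    rfl
  simp only [spectralGap, hform, MeanZero, inner_apply, sq]

theorem rayleigh_nonneg (f : V → ℝ) : 0 ≤ dirichletForm G π f / π.inner f f :=
  div_nonneg (dirichletForm_nonneg G π f) (inner_self_nonneg π f)

theorem spectralGap_nonneg : 0 ≤ spectralGap G π := by
  rw [spectralGap_eq]
  refine Real.sInf_nonneg ?_
  rintro r ⟨f, -, -, rfl⟩
  exact rayleigh_nonneg G π f

variable {π} in
theorem spectralGap_mul_le {f : V → ℝ} (hf : MeanZero π f) :
    spectralGap G π * π.inner f f ≤ dirichletForm G π f := by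
  rcases eq_or_ne f 0 with rfl | hf0
  · simp [dirichletForm_nonneg]
  rw [← le_div_iff₀ (inner_self_pos hf0), spectralGap_eq]
  refine csInf_le ⟨0, ?_⟩ ⟨f, hf0, hf, rfl⟩
  rintro r ⟨g, -, -, rfl⟩
  exact rayleigh_nonneg G π g

end SingleParticle

/-- An orthonormal basis of `L²(V, π)` made of eigenvectors of the one-particle generator, the
`i`-th one having eigenvalue `-eigenvalue i`. Orthonormality and completeness are encoded by
Parseval's identity. -/
structure Eigenbasis (G : WeightedGraph V) (π : SiteWeights V) where
  eigenvalue : Fin (Fintype.card V) → ℝ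
  vec : Fin (Fintype.card V) → V → ℝ
  singleGenerator_vec : ∀ i, singleGenerator G π (vec i) = -eigenvalue i • vec i
  inner_vec_self : ∀ i, π.inner (vec i) (vec i) = 1
  parseval : ∀ f g, ∑ i, π.inner f (vec i) * π.inner g (vec i) = π.inner f g

theorem nonempty_eigenbasis (G : WeightedGraph V) (π : SiteWeights V) :
    Nonempty (Eigenbasis G π) := by
  obtain ⟨lam, b, heigen, hnorm, hparseval⟩ := exists_eigenbasis_of_core
    (A := -singleGeneratorLinear G π) (Module.finrank_fintype_fun_eq_card ℝ)
    { inner := fun f g => π.inner f g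
      conj_inner_symm := fun f g => inner_comm π g f
      re_inner_nonneg := inner_self_nonneg π
      add_left := fun f g h => by rw [map_add, LinearMap.add_apply]
      smul_left := fun f g a => by rw [map_smul]; rfl
      definite := fun _ => eq_zero_of_inner_self_eq_zero }
    fun f g => by
      change π.inner (-singleGenerator G π f) g = π.inner f (-singleGenerator G π g)
      rw [map_neg, map_neg, LinearMap.neg_apply, inner_singleGenerator_comm]
  exact ⟨lam, b, fun i => by rw [neg_smul, ← heigen i]; exact (neg_neg _).symm, hnorm,
    fun f g => by simp only [inner_comm π g]; exact hparseval f g⟩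

namespace Eigenbasis

variable {G : WeightedGraph V} {π : SiteWeights V} (B : Eigenbasis G π)

theorem dirichletForm_vec (i : Fin (Fintype.card V)) :
    dirichletForm G π (B.vec i) = B.eigenvalue i := by
  rw [dirichletForm_eq, B.singleGenerator_vec, map_smul, LinearMap.smul_apply, B.inner_vec_self]
  simp

theorem eigenvalue_nonneg (i : Fin (Fintype.card V)) : 0 ≤ B.eigenvalue i :=
  B.dirichletForm_vec i ▸ dirichletForm_nonneg G π _

theorem inner_singleGenerator_vec (f : V → ℝ) (i : Fin (Fintype.card V)) :
    π.inner (singleGenerator G π f) (B.vec i) = -B.eigenvalue i * π.inner f (B.vec i) := by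
  rw [inner_singleGenerator_comm, B.singleGenerator_vec, map_smul, smul_eq_mul]

theorem dirichletForm_eq_sum (f : V → ℝ) :
    dirichletForm G π f = ∑ i, B.eigenvalue i * π.inner f (B.vec i) ^ 2 := by
  rw [dirichletForm_eq, ← B.parseval, ← Finset.sum_neg_distrib]
  refine Finset.sum_congr rfl fun i _ => ?_
  rw [B.inner_singleGenerator_vec]
  ring

theorem inner_vec_eq_zero {i : Fin (Fintype.card V)} (hi : B.eigenvalue i = 0) {f : V → ℝ}
    (hf : MeanZero π f) : π.inner f (B.vec i) = 0 := by
  obtain ⟨x⟩ := G.connected.nonempty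
  have hconst : B.vec i = B.vec i x • 1 := funext fun y => by
    simpa using eq_of_dirichletForm_eq_zero ((B.dirichletForm_vec i).trans hi) y x
  rw [hconst, map_smul, inner_comm, (meanZero_iff π).1 hf, smul_zero]

theorem meanZero_vec {i : Fin (Fintype.card V)} (hi : B.eigenvalue i ≠ 0) :
    MeanZero π (B.vec i) := by
  have hone := B.inner_singleGenerator_vec 1 i
  rw [inner_singleGenerator] at hone
  rw [meanZero_iff]
  simpa [WeightedGraph.edgeSum, hi] using hone

theorem spectralGap_le_eigenvalue {i : Fin (Fintype.card V)} (hi : B.eigenvalue i ≠ 0) :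
    spectralGap G π ≤ B.eigenvalue i := by
  have := spectralGap_mul_le G (B.meanZero_vec hi)
  rwa [B.inner_vec_self, mul_one, B.dirichletForm_vec] at this

theorem exists_eigenvalue_ne_zero (hV : 1 < Fintype.card V) : ∃ i, B.eigenvalue i ≠ 0 := by
  obtain ⟨x, y, hxy⟩ := Fintype.one_lt_card_iff.1 hV
  by_contra! hzero
  have hdipole := edgeWeight_mul_inner_dipole π hxy
  rw [← B.parseval, Finset.sum_eq_zero fun i _ => by
    rw [B.inner_vec_eq_zero (hzero i) (meanZero_dipole π x y), zero_mul]] at hdipole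
  simp at hdipole

theorem mul_inner_self_le_dirichletForm {g : ℝ}
    (hg : ∀ i, B.eigenvalue i ≠ 0 → g ≤ B.eigenvalue i) {f : V → ℝ} (hf : MeanZero π f) :
    g * π.inner f f ≤ dirichletForm G π f := by
  rw [B.dirichletForm_eq_sum, ← B.parseval, Finset.mul_sum]
  refine Finset.sum_le_sum fun i _ => ?_
  by_cases hi : B.eigenvalue i = 0
  · simp [B.inner_vec_eq_zero hi hf]
  · rw [← sq]
    exact mul_le_mul_of_nonneg_right (hg i hi) (sq_nonneg _)

theorem exists_eigenvalue_eq_spectralGap (hV : 1 < Fintype.card V) :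
    ∃ i, B.eigenvalue i ≠ 0 ∧ B.eigenvalue i = spectralGap G π := by
  obtain ⟨j, hj⟩ := B.exists_eigenvalue_ne_zero hV
  obtain ⟨i, hi, hmin⟩ := Finset.exists_min_image
    (Finset.univ.filter fun i => B.eigenvalue i ≠ 0) B.eigenvalue ⟨j, by simpa using hj⟩
  have hi0 : B.eigenvalue i ≠ 0 := (Finset.mem_filter.1 hi).2
  refine ⟨i, hi0, (B.spectralGap_le_eigenvalue hi0).antisymm' ?_⟩
  have hvec : B.vec i ≠ 0 := fun h0 => by simpa [h0] using B.inner_vec_self i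
  rw [spectralGap_eq]
  refine le_csInf ⟨_, B.vec i, hvec, B.meanZero_vec hi0, rfl⟩ ?_
  rintro r ⟨f, hf0, hf, rfl⟩
  rw [le_div_iff₀ (inner_self_pos hf0)]
  exact B.mul_inner_self_le_dirichletForm (fun k hk => hmin k (by simpa using hk)) hf

/-- The squared norm `‖e^{rL} f‖²` in `L²(V, π)`, expressed in the eigenbasis. -/
def heatNormSq (r : ℝ) (f : V → ℝ) : ℝ :=
  ∑ i, Real.exp (-(2 * B.eigenvalue i * r)) * π.inner f (B.vec i) ^ 2

theorem heatNormSq_nonneg (r : ℝ) (f : V → ℝ) : 0 ≤ B.heatNormSq r f :=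
  Finset.sum_nonneg fun _ _ => mul_nonneg (Real.exp_pos _).le (sq_nonneg _)

theorem heatNormSq_zero (f : V → ℝ) : B.heatNormSq 0 f = π.inner f f := by
  simp only [heatNormSq, mul_zero, neg_zero, Real.exp_zero, one_mul, sq, B.parseval]

theorem heatNormSq_le {f : V → ℝ} (hf : MeanZero π f) {r s : ℝ} (hrs : r ≤ s) :
    B.heatNormSq s f ≤ Real.exp (-(2 * spectralGap G π * (s - r))) * B.heatNormSq r f := by
  rw [heatNormSq, heatNormSq, Finset.mul_sum]
  refine Finset.sum_le_sum fun i _ => ?_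
  by_cases hi : B.eigenvalue i = 0
  · simp [B.inner_vec_eq_zero hi hf]
  · rw [← mul_assoc, ← Real.exp_add]
    refine mul_le_mul_of_nonneg_right (Real.exp_le_exp.2 ?_) (sq_nonneg _)
    nlinarith [B.spectralGap_le_eigenvalue hi]

theorem heatNormSq_le_inner_self {f : V → ℝ} (hf : MeanZero π f) {r : ℝ} (hr : 0 ≤ r) :
    B.heatNormSq r f ≤ π.inner f f := by
  refine (B.heatNormSq_le hf hr).trans ?_
  rw [B.heatNormSq_zero]
  refine mul_le_of_le_one_left (inner_self_nonneg π f) (Real.exp_le_one_iff.2 ?_)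
  have := mul_nonneg (spectralGap_nonneg G π) hr
  linarith

theorem heatNormSq_sub_le (r : ℝ) (f h : V → ℝ) :
    B.heatNormSq r (f - h) ≤ 2 * B.heatNormSq r f + 2 * B.heatNormSq r h := by
  simp only [heatNormSq, Finset.mul_sum, ← Finset.sum_add_distrib]
  refine Finset.sum_le_sum fun i _ => ?_
  rw [map_sub, LinearMap.sub_apply]
  nlinarith [mul_nonneg (Real.exp_pos (-(2 * B.eigenvalue i * r))).le
    (sq_nonneg (π.inner f (B.vec i) + π.inner h (B.vec i)))]

end Eigenbasis

theorem spectralGap_pos (G : WeightedGraph V) (π : SiteWeights V) (hV : 1 < Fintype.card V) :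
    0 < spectralGap G π := by
  obtain ⟨B⟩ := nonempty_eigenbasis G π
  obtain ⟨i, hi, hgap⟩ := B.exists_eigenvalue_eq_spectralGap hV
  exact hgap ▸ (B.eigenvalue_nonneg i).lt_of_ne' hi

theorem exists_gap_eigenfunction (G : WeightedGraph V) (π : SiteWeights V)
    (hV : 1 < Fintype.card V) :
    ∃ (f : V → ℝ) (z : V), singleGenerator G π f = -spectralGap G π • f ∧ MeanZero π f ∧
      0 < f z ∧ ∀ x, |f x| ≤ f z := by
  obtain ⟨B⟩ := nonempty_eigenbasis G π
  obtain ⟨i, hi, hgap⟩ := B.exists_eigenvalue_eq_spectralGap hV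
  have hmean := B.meanZero_vec hi
  have heigen := B.singleGenerator_vec i
  rw [hgap] at heigen
  have : Nonempty V := G.connected.nonempty
  obtain ⟨z, hz⟩ := Finite.exists_max fun x => |B.vec i x|
  have hne : B.vec i z ≠ 0 := fun h0 => by
    have hvec : B.vec i = 0 := funext fun x =>
      abs_nonpos_iff.1 ((hz x).trans_eq (by rw [h0, abs_zero]))
    simpa [hvec] using B.inner_vec_self i
  rcases hne.lt_or_gt with hneg | hpos
  · refine ⟨-B.vec i, z, ?_, ?_, neg_pos.2 hneg, fun x => ?_⟩
    · rw [smul_neg, ← heigen]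
      exact map_neg (singleGeneratorLinear G π) (B.vec i)
    · rw [meanZero_iff] at hmean ⊢
      rw [map_neg, hmean, neg_zero]
    · rw [Pi.neg_apply, abs_neg]
      exact (hz x).trans_eq (abs_of_neg hneg)
  · exact ⟨B.vec i, z, heigen, hmean, hpos, fun x => (hz x).trans_eq (abs_of_pos hpos)⟩

/-! ### Expectations along the Averaging process -/

section BanachAlgebra

variable {A : Type*} [NormedRing A] [NormedAlgebra ℝ A] [CompleteSpace A]

theorem exp_add_smul (a : A) (s t : ℝ) :
    NormedSpace.exp ((s + t) • a) = NormedSpace.exp (s • a) * NormedSpace.exp (t • a) := by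
  let _ : NormedAlgebra ℚ A := NormedAlgebra.restrictScalars ℚ ℝ A
  rw [add_smul]
  exact NormedSpace.exp_add_of_commute (((Commute.refl a).smul_left s).smul_right t)

theorem hasDerivAt_clm_exp_smul (φ : A →L[ℝ] ℝ) (a : A) (t : ℝ) :
    HasDerivAt (fun t : ℝ => φ (NormedSpace.exp (t • a))) (φ (NormedSpace.exp (t • a) * a)) t :=
  φ.hasFDerivAt.comp_hasDerivAt t (hasDerivAt_exp_smul_const a t)

end BanachAlgebra

/-- The expectation `F ↦ E_η[F(η_t)]` as a functional on `C(Δ)`. It is defined by the exponential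
formula for every real `t`, so that it can be differentiated at time `0`, but it is an
expectation only for `0 ≤ t`. -/
def expectation (G : WeightedGraph V) (π : SiteWeights V) (η : stdSimplex ℝ V) (t : ℝ) :
    C(stdSimplex ℝ V, ℝ) →L[ℝ] ℝ :=
  (ContinuousMap.evalCLM ℝ η).comp
    (NormedSpace.exp (t • generator G π) : C(stdSimplex ℝ V, ℝ) →L[ℝ] C(stdSimplex ℝ V, ℝ))

section Expectation

variable (G : WeightedGraph V) (π : SiteWeights V) (η : stdSimplex ℝ V)
  {F H : C(stdSimplex ℝ V, ℝ)} {s t : ℝ}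

theorem expectation_eq_integral_law (t : ℝ≥0) (F : C(stdSimplex ℝ V, ℝ)) :
    expectation G π η t F = ∫ ζ, F ζ ∂(law G π t η) :=
  (integral_law G π t η F).symm

theorem expectation_zero (F : C(stdSimplex ℝ V, ℝ)) : expectation G π η 0 F = F η := by
  have hzero : (0 : ℝ) • generator G π = 0 := zero_smul ℝ (generator G π)
  rw [expectation, hzero, NormedSpace.exp_zero]
  rfl

theorem hasDerivAt_expectation (F : C(stdSimplex ℝ V, ℝ)) (t : ℝ) :
    HasDerivAt (fun t => expectation G π η t F) (expectation G π η t (generator G π F)) t := by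
  exact hasDerivAt_clm_exp_smul (A := C(stdSimplex ℝ V, ℝ) →L[ℝ] C(stdSimplex ℝ V, ℝ))
    ((ContinuousMap.evalCLM ℝ η).comp (ContinuousLinearMap.apply ℝ C(stdSimplex ℝ V, ℝ) F))
    (generator G π) t

theorem expectation_one (ht : 0 ≤ t) : expectation G π η t 1 = 1 :=
  congrArg (fun F : C(stdSimplex ℝ V, ℝ) => F η) (semigroup_one G π ⟨t, ht⟩)

theorem expectation_nonneg (ht : 0 ≤ t) (hF : ∀ ζ, 0 ≤ F ζ) : 0 ≤ expectation G π η t F :=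
  semigroup_nonneg G π ⟨t, ht⟩ F hF η

theorem expectation_mono (ht : 0 ≤ t) (h : ∀ ζ, F ζ ≤ H ζ) :
    expectation G π η t F ≤ expectation G π η t H := by
  rw [← sub_nonneg, ← map_sub]
  exact expectation_nonneg G π η ht fun ζ => sub_nonneg.2 (h ζ)

theorem expectation_add_le (hs : 0 ≤ s) (h : ∀ ζ, expectation G π ζ t F ≤ H ζ) :
    expectation G π η (s + t) F ≤ expectation G π η s H := by
  have hmarkov : expectation G π η (s + t) F = expectation G π η s
      ((NormedSpace.exp (t • generator G π) :
        C(stdSimplex ℝ V, ℝ) →L[ℝ] C(stdSimplex ℝ V, ℝ)) F) :=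
    congrArg (fun T : C(stdSimplex ℝ V, ℝ) →L[ℝ] C(stdSimplex ℝ V, ℝ) => T F η)
      (exp_add_smul (A := C(stdSimplex ℝ V, ℝ) →L[ℝ] C(stdSimplex ℝ V, ℝ)) (generator G π) s t)
  exact hmarkov ▸ expectation_mono G π η hs h

theorem expectation_le_exp_mul {c : ℝ} (ht : 0 ≤ t) (h : ∀ ζ, generator G π F ζ ≤ c * F ζ) :
    expectation G π η t F ≤ Real.exp (c * t) * F η := by
  have hexp : ∀ s, HasDerivAt (fun s => Real.exp (-(c * s))) (Real.exp (-(c * s)) * -c) s :=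
    fun s => by simpa using (((hasDerivAt_id s).const_mul c).neg).exp
  have hle := sub_le_sub_of_hasDerivAt_le ht
    (fun s _ => (hexp s).mul (hasDerivAt_expectation G π η F s))
    (fun s _ => hasDerivAt_const s (0 : ℝ)) fun s hs => by
      have hgen : expectation G π η s (generator G π F) ≤ c * expectation G π η s F := by
        rw [← smul_eq_mul, ← map_smul]
        exact expectation_mono G π η hs.1 h
      have := mul_le_mul_of_nonneg_left hgen (Real.exp_pos (-(c * s))).le
      linarith
  simp only [Pi.mul_apply, mul_zero, neg_zero, Real.exp_zero, expectation_zero, one_mul, sub_self,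
    sub_nonpos] at hle
  rwa [Real.exp_neg, inv_mul_le_iff₀ (Real.exp_pos _)] at hle

theorem expectation_eq_exp_mul {c : ℝ} (ht : 0 ≤ t) (h : generator G π F = c • F) :
    expectation G π η t F = Real.exp (c * t) * F η := by
  refine (expectation_le_exp_mul G π η ht fun ζ => (DFunLike.congr_fun h ζ).le).antisymm ?_
  have hneg := expectation_le_exp_mul G π η (F := -F) (c := c) ht fun ζ => by
    rw [map_neg, h, ← smul_neg]
    rfl
  rwa [map_neg, ContinuousMap.neg_apply, mul_neg, neg_le_neg_iff] at hneg

theorem expectation_antitone (h : ∀ ζ, generator G π F ζ ≤ 0) (hs : 0 ≤ s) (hst : s ≤ t) :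
    expectation G π η t F ≤ expectation G π η s F := by
  have hle := sub_le_sub_of_hasDerivAt_le hst
    (fun r _ => hasDerivAt_expectation G π η F r) (fun r _ => hasDerivAt_const r (0 : ℝ))
    fun r hr => by
      have := expectation_mono G π η (hs.trans hr.1) (H := 0) h
      rwa [map_zero] at this
  linarith

theorem rpow_expectation_le {q : ℝ} (hq : 1 ≤ q) (ht : 0 ≤ t) (hF : ∀ ζ, 0 ≤ F ζ)
    (h : ∀ ζ, F ζ ^ q ≤ H ζ) : expectation G π η t F ^ q ≤ expectation G π η t H := by
  lift t to ℝ≥0 using ht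
  have hint : ∀ f : stdSimplex ℝ V → ℝ, Continuous f → Integrable f (law G π t η) :=
    fun f hf => hf.integrable_of_hasCompactSupport (HasCompactSupport.of_compactSpace f)
  have hpow : Continuous fun ζ => F ζ ^ q :=
    F.continuous.rpow_const fun _ => Or.inr (by linarith)
  rw [expectation_eq_integral_law, expectation_eq_integral_law]
  calc (∫ ζ, F ζ ∂(law G π t η)) ^ q ≤ ∫ ζ, F ζ ^ q ∂(law G π t η) :=
        (convexOn_rpow hq).map_integral_le (Real.continuous_rpow_const (by linarith)).continuousOn
          isClosed_Ici (ae_of_all _ hF) (hint _ F.continuous) (hint _ hpow)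
    _ ≤ ∫ ζ, H ζ ∂(law G π t η) := integral_mono (hint _ hpow) (hint _ H.continuous) h

theorem generator_apply (F : C(stdSimplex ℝ V, ℝ)) (ζ : stdSimplex ℝ V) :
    generator G π F ζ = G.edgeSum fun x y => F (averageMap π x y ζ) - F ζ := by
  simp [generator, WeightedGraph.edgeSum, averageOp]

end Expectation

/-! ### Quadratic functionals of the Averaging process -/

/-- The centered density `η / π - 1`. -/
def centered (π : SiteWeights V) (ζ : stdSimplex ℝ V) : V → ℝ := fun x => ζ x / π.w x - 1

section Quadratic

variable (G : WeightedGraph V) (π : SiteWeights V)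

theorem continuous_centered : Continuous (centered π) :=
  continuous_pi fun x =>
    (((continuous_apply x).comp continuous_subtype_val).div_const _).sub continuous_const

theorem continuous_centered_apply (x : V) : Continuous fun ζ => centered π ζ x :=
  (continuous_apply x).comp (continuous_centered π)

theorem meanZero_centered (ζ : stdSimplex ℝ V) : MeanZero π (centered π ζ) := by
  have hterm : ∀ x, π.w x * centered π ζ x = ζ.1 x - π.w x := fun x => by
    have := (π.pos x).ne'
    change π.w x * (ζ.1 x / π.w x - 1) = _
    field_simp
  simp only [MeanZero, hterm, Finset.sum_sub_distrib, ζ.2.2, π.sum_eq_one, sub_self]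

theorem centered_vertex [DecidableEq V] (x : V) :
    centered π (stdSimplex.vertex x) = diracDensity π x - 1 := by
  funext z
  change (Pi.single x 1 : V → ℝ) z / π.w z - 1 = diracDensity π x z - 1
  rcases eq_or_ne z x with rfl | hzx
  · simp [diracDensity]
  · simp [diracDensity, hzx]

theorem dipole_eq_centered_sub [DecidableEq V] (x y : V) :
    dipole π x y = centered π (stdSimplex.vertex x) - centered π (stdSimplex.vertex y) := by
  rw [centered_vertex, centered_vertex, sub_sub_sub_cancel_right, dipole]

theorem centered_averageMap (x y : V) (ζ : stdSimplex ℝ V) :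
    centered π (averageMap π x y ζ) = centered π ζ -
      (edgeWeight π x y * (centered π ζ x - centered π ζ y)) • dipole π x y := by
  classical
  rw [← pairResample_eq]
  have hx := π.pos x
  have hy := π.pos y
  funext z
  change averageFun π x y ζ.1 z / π.w z - 1 = pairResample π x y (fun x => ζ.1 x / π.w x - 1) z
  unfold averageFun pairResample
  by_cases hzx : z = x
  · subst hzx
    simp only [if_true, true_or]
    field_simp
    ring
  · by_cases hzy : z = y
    · subst hzy
      simp only [hzx, if_true, if_false, or_true]
      field_simp
      ring
    · simp [hzx, hzy]

theorem continuous_inner_centered {g : stdSimplex ℝ V → V → ℝ} (hg : ∀ x, Continuous (g · x)) :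
    Continuous fun ζ => π.inner (centered π ζ) (g ζ) :=
  continuous_finsetSum _ fun x _ =>
    continuous_const.mul ((continuous_centered_apply π x).mul (hg x))

/-- The linear functional `η ↦ ⟨η / π - 1, g⟩`. -/
def coordFun : (V → ℝ) →ₗ[ℝ] C(stdSimplex ℝ V, ℝ) where
  toFun g := ⟨fun ζ => π.inner (centered π ζ) g,
    continuous_inner_centered π fun _ => continuous_const⟩
  map_add' g h := ContinuousMap.ext fun ζ => map_add (π.inner (centered π ζ)) g h
  map_smul' a g := ContinuousMap.ext fun ζ => map_smul (π.inner (centered π ζ)) a g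

/-- The squared distance `η ↦ ‖η / π - 1‖₂²` to equilibrium. -/
def sqDist : C(stdSimplex ℝ V, ℝ) :=
  ⟨fun ζ => π.inner (centered π ζ) (centered π ζ),
    continuous_inner_centered π (continuous_centered_apply π)⟩

/-- The functional `η ↦ ∑_{xy ∈ E} c_{xy} a_{xy} (ψ(x) - ψ(y))²` with `ψ = η / π - 1`, which is
the Dirichlet form of `ψ` when `a` is `edgeWeight π`. -/
def energy : (V → V → ℝ) →ₗ[ℝ] C(stdSimplex ℝ V, ℝ) where
  toFun a := ⟨fun ζ => G.edgeSum fun x y => a x y * (centered π ζ x - centered π ζ y) ^ 2, by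
    have := continuous_centered_apply π
    unfold WeightedGraph.edgeSum
    fun_prop⟩
  map_add' a b := by
    ext ζ
    simp only [ContinuousMap.coe_mk, ContinuousMap.add_apply, Pi.add_apply, add_mul,
      WeightedGraph.edgeSum_add]
  map_smul' r a := by
    ext ζ
    simp only [ContinuousMap.coe_mk, ContinuousMap.smul_apply, Pi.smul_apply, smul_eq_mul,
      mul_assoc, RingHom.id_apply]
    exact G.edgeSum_smul r _

theorem coordFun_apply (g : V → ℝ) (ζ : stdSimplex ℝ V) :
    coordFun π g ζ = π.inner (centered π ζ) g := rfl

theorem coordFun_vertex [DecidableEq V] {g : V → ℝ} (hg : MeanZero π g) (x : V) :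
    coordFun π g (stdSimplex.vertex x) = g x := by
  rw [coordFun_apply, centered_vertex, map_sub, LinearMap.sub_apply, inner_diracDensity,
    (meanZero_iff π).1 hg, sub_zero]

theorem sqDist_apply (ζ : stdSimplex ℝ V) :
    sqDist π ζ = π.inner (centered π ζ) (centered π ζ) := rfl

theorem energy_apply (a : V → V → ℝ) (ζ : stdSimplex ℝ V) :
    energy G π a ζ =
      G.edgeSum fun x y => a x y * (centered π ζ x - centered π ζ y) ^ 2 := rfl

theorem energy_edgeWeight (ζ : stdSimplex ℝ V) :
    energy G π (edgeWeight π) ζ = dirichletForm G π (centered π ζ) := rfl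

theorem sqDist_nonneg (ζ : stdSimplex ℝ V) : 0 ≤ sqDist π ζ :=
  inner_self_nonneg π _

theorem energy_mono {a b : V → V → ℝ} (h : ∀ x y, a x y ≤ b x y) (ζ : stdSimplex ℝ V) :
    energy G π a ζ ≤ energy G π b ζ :=
  G.edgeSum_le_edgeSum fun x y => mul_le_mul_of_nonneg_right (h x y) (sq_nonneg _)

theorem coordFun_averageMap (g : V → ℝ) (x y : V) (ζ : stdSimplex ℝ V) :
    coordFun π g (averageMap π x y ζ) = coordFun π g ζ -
      edgeWeight π x y * ((centered π ζ x - centered π ζ y) * (g x - g y)) := by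
  simp only [coordFun_apply, centered_averageMap, map_sub, map_smul, LinearMap.sub_apply,
    LinearMap.smul_apply, inner_dipole, smul_eq_mul, mul_assoc]

theorem sqDist_averageMap (x y : V) (ζ : stdSimplex ℝ V) :
    sqDist π (averageMap π x y ζ) =
      sqDist π ζ - edgeWeight π x y * (centered π ζ x - centered π ζ y) ^ 2 := by
  rcases eq_or_ne x y with rfl | hxy
  · simp [sqDist_apply, centered_averageMap]
  have hdipole := edgeWeight_mul_inner_dipole π hxy
  simp only [sqDist_apply, centered_averageMap, map_sub, map_smul, LinearMap.sub_apply,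
    LinearMap.smul_apply, inner_comm π (centered π ζ) (dipole π x y), inner_dipole π x y
      (centered π ζ), smul_eq_mul]
  linear_combination (edgeWeight π x y * (centered π ζ x - centered π ζ y) ^ 2) * hdipole

theorem generator_coordFun (g : V → ℝ) :
    generator G π (coordFun π g) = coordFun π (singleGenerator G π g) := by
  ext ζ
  rw [coordFun_apply, ← inner_singleGenerator_comm, inner_singleGenerator,
    ← WeightedGraph.edgeSum_neg]
  simp only [generator_apply, coordFun_averageMap, sub_sub_cancel_left]

theorem generator_sqDist : generator G π (sqDist π) = -energy G π (edgeWeight π) := by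
  ext ζ
  rw [ContinuousMap.neg_apply, energy_apply, ← WeightedGraph.edgeSum_neg]
  simp only [generator_apply, sqDist_averageMap, sub_sub_cancel_left]

theorem generator_coordFun_sq (g : V → ℝ) :
    generator G π (coordFun π g ^ 2) =
      (2 : ℝ) • (coordFun π g * generator G π (coordFun π g)) +
        energy G π (fun x y => (edgeWeight π x y * (g x - g y)) ^ 2) := by
  ext ζ
  simp only [ContinuousMap.add_apply, ContinuousMap.smul_apply, ContinuousMap.mul_apply,
    generator_apply, energy_apply, ← smul_eq_mul (coordFun π g ζ), ← WeightedGraph.edgeSum_smul,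
    ← WeightedGraph.edgeSum_add, ContinuousMap.pow_apply, coordFun_averageMap]
  refine congrArg G.edgeSum (funext₂ fun x y => ?_)
  simp only [smul_eq_mul]
  ring

theorem generator_sqDist_le (ζ : stdSimplex ℝ V) :
    generator G π (sqDist π) ζ ≤ -spectralGap G π * sqDist π ζ := by
  have := spectralGap_mul_le G (meanZero_centered π ζ)
  rw [generator_sqDist, ContinuousMap.neg_apply, energy_edgeWeight, sqDist_apply]
  linarith

variable (η : stdSimplex ℝ V) {s t : ℝ}

theorem hasDerivAt_expectation_sqDist (t : ℝ) :
    HasDerivAt (fun t => expectation G π η t (sqDist π))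
      (-expectation G π η t (energy G π (edgeWeight π))) t := by
  have := hasDerivAt_expectation G π η (sqDist π) t
  rwa [generator_sqDist, map_neg] at this

theorem expectation_sqDist_antitone (hs : 0 ≤ s) (hst : s ≤ t) :
    expectation G π η t (sqDist π) ≤ expectation G π η s (sqDist π) := by
  refine expectation_antitone G π η (fun ζ => ?_) hs hst
  rw [generator_sqDist]
  exact neg_nonpos.2 (dirichletForm_nonneg G π _)

theorem expectation_sqDist_le_exp (ht : 0 ≤ t) :
    expectation G π η t (sqDist π) ≤ Real.exp (-spectralGap G π * t) * sqDist π η :=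
  expectation_le_exp_mul G π η ht (generator_sqDist_le G π)

end Quadratic

/-! ### Duhamel's formula -/

namespace Eigenbasis

variable {G : WeightedGraph V} {π : SiteWeights V} (B : Eigenbasis G π)

/-- The functional `η ↦ ‖e^{rL}(η / π - 1)‖₂²`. -/
def smoothedSqDist (r : ℝ) : C(stdSimplex ℝ V, ℝ) :=
  ∑ i, Real.exp (-(2 * B.eigenvalue i * r)) • coordFun π (B.vec i) ^ 2

theorem smoothedSqDist_apply (r : ℝ) (ζ : stdSimplex ℝ V) :
    B.smoothedSqDist r ζ = B.heatNormSq r (centered π ζ) := by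
  simp [smoothedSqDist, heatNormSq, ContinuousMap.sum_apply, coordFun_apply]

theorem smoothedSqDist_zero : B.smoothedSqDist 0 = sqDist π :=
  ContinuousMap.ext fun ζ => by rw [smoothedSqDist_apply, heatNormSq_zero, sqDist_apply]

theorem generator_coordFun_vec_sq (i : Fin (Fintype.card V)) :
    generator G π (coordFun π (B.vec i) ^ 2) =
      -(2 * B.eigenvalue i) • coordFun π (B.vec i) ^ 2 +
        energy G π (fun x y => (edgeWeight π x y * (B.vec i x - B.vec i y)) ^ 2) := by
  rw [generator_coordFun_sq, generator_coordFun, B.singleGenerator_vec, map_smul, mul_smul_comm,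
    smul_smul, ← sq, mul_neg]

/-- The interpolation `s ↦ E_η ‖e^{(t-s)L}(η_s / π - 1)‖₂²` of Duhamel's formula. -/
def interpolation (η : stdSimplex ℝ V) (t s : ℝ) : ℝ :=
  expectation G π η s (B.smoothedSqDist (t - s))

/-- The squared norm `‖e^{rL} u‖₂²` of the jump `u` made by the density when the edge `xy` rings,
per unit of squared discrepancy across that edge. -/
def jumpNormSq (r : ℝ) (x y : V) : ℝ :=
  edgeWeight π x y ^ 2 * B.heatNormSq r (dipole π x y)

theorem jumpNormSq_nonneg (r : ℝ) (x y : V) : 0 ≤ B.jumpNormSq r x y :=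
  mul_nonneg (sq_nonneg _) (B.heatNormSq_nonneg _ _)

theorem jumpNormSq_le {r κ : ℝ} {x y : V}
    (h : edgeWeight π x y * B.heatNormSq r (dipole π x y) ≤ κ) :
    B.jumpNormSq r x y ≤ κ * edgeWeight π x y := by
  rw [jumpNormSq, sq, mul_assoc, mul_comm κ]
  exact mul_le_mul_of_nonneg_left h (edgeWeight_pos π x y).le

theorem jumpNormSq_eq_sum (r : ℝ) :
    B.jumpNormSq r = ∑ i, Real.exp (-(2 * B.eigenvalue i * r)) •
      fun x y => (edgeWeight π x y * (B.vec i x - B.vec i y)) ^ 2 := by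
  funext x y
  simp only [jumpNormSq, heatNormSq, inner_dipole, Finset.sum_apply, Pi.smul_apply, smul_eq_mul,
    Finset.mul_sum]
  exact Finset.sum_congr rfl fun i _ => by ring

variable (η : stdSimplex ℝ V)

theorem interpolation_zero (t : ℝ) :
    B.interpolation η t 0 = B.heatNormSq t (centered π η) := by
  rw [interpolation, sub_zero, expectation_zero, smoothedSqDist_apply]

theorem interpolation_self (t : ℝ) :
    B.interpolation η t t = expectation G π η t (sqDist π) := by
  rw [interpolation, sub_self, smoothedSqDist_zero]

theorem hasDerivAt_interpolation (t s : ℝ) :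
    HasDerivAt (B.interpolation η t)
      (expectation G π η s (energy G π (B.jumpNormSq (t - s)))) s := by
  have hterm : ∀ i ∈ Finset.univ, HasDerivAt
      (fun s => Real.exp (-(2 * B.eigenvalue i * (t - s))) *
        expectation G π η s (coordFun π (B.vec i) ^ 2))
      (Real.exp (-(2 * B.eigenvalue i * (t - s))) * expectation G π η s
        (energy G π fun x y => (edgeWeight π x y * (B.vec i x - B.vec i y)) ^ 2)) s := by
    intro i _
    have hexp : HasDerivAt (fun s => Real.exp (-(2 * B.eigenvalue i * (t - s))))
        (Real.exp (-(2 * B.eigenvalue i * (t - s))) * (2 * B.eigenvalue i)) s := by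
      simpa using ((((hasDerivAt_id s).const_sub t).const_mul (2 * B.eigenvalue i)).neg).exp
    have hmul := hexp.mul (hasDerivAt_expectation G π η (coordFun π (B.vec i) ^ 2) s)
    rw [B.generator_coordFun_vec_sq, map_add, map_smul, smul_eq_mul] at hmul
    convert! hmul using 1
    ring
  have hsum := HasDerivAt.fun_sum hterm
  simp only [jumpNormSq_eq_sum, map_sum, map_smul, smul_eq_mul]
  refine hsum.congr_of_eventuallyEq (.of_forall fun s => ?_)
  simp only [interpolation, smoothedSqDist, map_sum, map_smul, smul_eq_mul]

theorem expectation_energy_jumpNormSq_le {r s κ : ℝ} (hs : 0 ≤ s)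
    (hκ : ∀ x y, edgeWeight π x y * B.heatNormSq r (dipole π x y) ≤ κ) :
    expectation G π η s (energy G π (B.jumpNormSq r)) ≤
      κ * expectation G π η s (energy G π (edgeWeight π)) := by
  rw [← smul_eq_mul, ← map_smul, ← map_smul]
  exact expectation_mono G π η hs
    (energy_mono G π fun x y => B.jumpNormSq_le (hκ x y))

variable {t s : ℝ}

theorem heatNormSq_centered_le (ht : 0 ≤ t) :
    B.heatNormSq t (centered π η) ≤ expectation G π η t (sqDist π) := by
  rw [← B.interpolation_self, ← B.interpolation_zero]
  refine sub_nonneg.1 ((sub_self (0 : ℝ)).symm.le.trans <| sub_le_sub_of_hasDerivAt_le ht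
    (fun r _ => hasDerivAt_const r 0) (fun r _ => B.hasDerivAt_interpolation η t r)
    fun r hr => expectation_nonneg G π η hr.1 fun ζ => ?_)
  exact G.edgeSum_nonneg fun x y => mul_nonneg (B.jumpNormSq_nonneg _ x y) (sq_nonneg _)

theorem two_mul_expectation_sqDist_le (hs : 0 ≤ s) (hst : s ≤ t) :
    2 * expectation G π η t (sqDist π) ≤
      B.interpolation η t s + expectation G π η s (sqDist π) := by
  have hmono := sub_le_sub_of_hasDerivAt_le hst
    (fun r _ => B.hasDerivAt_interpolation η t r)
    (fun r _ => (hasDerivAt_expectation_sqDist G π η r).neg) fun r hr => by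
      have := B.expectation_energy_jumpNormSq_le η (r := t - r) (hs.trans hr.1) fun x y =>
        (mul_le_mul_of_nonneg_left (B.heatNormSq_le_inner_self (meanZero_dipole π x y)
          (sub_nonneg.2 hr.2)) (edgeWeight_pos π x y).le).trans
          (edgeWeight_mul_inner_dipole_le_one π x y)
      linarith
  simp only [Pi.neg_apply, B.interpolation_self] at hmono
  linarith

theorem interpolation_sub_le {β : ℝ} (hs : 0 ≤ s) (hst : s ≤ t) (hβ : 0 ≤ β)
    (hκ : ∀ r, t - s ≤ r → ∀ x y, edgeWeight π x y * B.heatNormSq r (dipole π x y) ≤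
      β * Real.exp (-(2 * spectralGap G π * r))) :
    B.interpolation η t s - B.interpolation η t 0 ≤
      2 * β * Real.exp (-(spectralGap G π * t)) * sqDist π η := by
  set g := spectralGap G π
  have hg : 0 ≤ g := spectralGap_nonneg G π
  set v := sqDist π η
  have hv : 0 ≤ v := sqDist_nonneg π η
  have hweight : ∀ r, HasDerivAt (fun r => β * Real.exp (-(2 * g * (t - r))))
      (β * (Real.exp (-(2 * g * (t - r))) * (2 * g))) r := fun r => by
    simpa using ((((hasDerivAt_id r).const_sub t).const_mul (2 * g)).neg.exp).const_mul β
  have herror : ∀ r, HasDerivAt (fun r => 2 * β * v * Real.exp (g * r - 2 * g * t))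
      (2 * β * v * (Real.exp (g * r - 2 * g * t) * g)) r := fun r => by
    simpa using ((((hasDerivAt_id r).const_mul g).sub_const (2 * g * t)).exp).const_mul (2 * β * v)
  have hmono := sub_le_sub_of_hasDerivAt_le hs
    (fun r _ => B.hasDerivAt_interpolation η t r)
    (fun r _ => (herror r).sub ((hweight r).mul (hasDerivAt_expectation_sqDist G π η r)))
    fun r hr => by
      have henergy := B.expectation_energy_jumpNormSq_le η hr.1 (hκ (t - r) (by linarith [hr.2]))
      have hdecay := mul_le_mul_of_nonneg_left (expectation_sqDist_le_exp G π η hr.1)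
        (mul_nonneg (mul_nonneg hβ (Real.exp_pos (-(2 * g * (t - r)))).le) hg)
      have hexp : Real.exp (g * r - 2 * g * t) =
          Real.exp (-(2 * g * (t - r))) * Real.exp (-g * r) := by
        rw [← Real.exp_add]
        ring_nf
      rw [hexp]
      linarith
  simp only [Pi.sub_apply, Pi.mul_apply, expectation_zero, sub_zero, mul_zero, zero_sub] at hmono
  have hlast : 0 ≤ β * Real.exp (-(2 * g * (t - s))) * expectation G π η s (sqDist π) :=
    mul_nonneg (by positivity) (expectation_nonneg G π η hs (sqDist_nonneg π))
  have hstart : 0 ≤ β * v * Real.exp (-(2 * g * t)) := by positivity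
  have herror_last : β * v * Real.exp (g * s - 2 * g * t) ≤ β * v * Real.exp (-(g * t)) :=
    mul_le_mul_of_nonneg_left (Real.exp_le_exp.2 (by nlinarith)) (by positivity)
  linarith

/-- One half comes from the noise produced in the last `ε` units of time, which `e^{rL}` does not
damp; the noise produced before is damped by the factor `β`. -/
theorem expectation_sqDist_le_half {ε β : ℝ} (hε : 0 ≤ ε) (hεt : ε ≤ t) (hβ : 0 ≤ β)
    (hκ : ∀ r, ε ≤ r → ∀ x y, edgeWeight π x y * B.heatNormSq r (dipole π x y) ≤
      β * Real.exp (-(2 * spectralGap G π * r))) :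
    expectation G π η t (sqDist π) ≤ 1 / 2 * expectation G π η (t - ε) (sqDist π) + 1 / 2 *
      ((Real.exp (-(2 * spectralGap G π * t)) + 2 * β * Real.exp (-(spectralGap G π * t)))
        * sqDist π η) := by
  have hnear := B.two_mul_expectation_sqDist_le η (sub_nonneg.2 hεt) (sub_le_self t hε)
  have hfar := B.interpolation_sub_le η (sub_nonneg.2 hεt) (sub_le_self t hε) hβ
    (by simpa only [sub_sub_cancel] using hκ)
  have hheat := B.heatNormSq_le (meanZero_centered π η) (hε.trans hεt)
  rw [B.heatNormSq_zero, sub_zero, ← sqDist_apply] at hheat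
  rw [B.interpolation_zero] at hfar
  linarith

end Eigenbasis

/-! ### Nash inequality and ultracontractivity -/

section Norm

variable (π : SiteWeights V)

theorem SiteWeights.norm_nonneg (p : ℝ) (ψ : V → ℝ) : 0 ≤ π.norm p ψ :=
  Real.rpow_nonneg (Finset.sum_nonneg fun x _ => mul_nonneg (π.pos x).le (by positivity)) _

theorem SiteWeights.norm_one_eq (ψ : V → ℝ) : π.norm 1 ψ = ∑ x, π.w x * |ψ x| := by
  simp [SiteWeights.norm]

theorem SiteWeights.norm_two_eq (ψ : V → ℝ) : π.norm 2 ψ = √(π.inner ψ ψ) := by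
  simp only [SiteWeights.norm, Real.sqrt_eq_rpow, inner_apply, Real.rpow_two, sq_abs, ← sq]

theorem SiteWeights.norm_le_norm {p q : ℝ} (hp : 0 < p) (hpq : p ≤ q) (ψ : V → ℝ) :
    π.norm p ψ ≤ π.norm q ψ := by
  have hsum : ∀ r : ℝ, 0 ≤ ∑ x, π.w x * |ψ x| ^ r := fun r =>
    Finset.sum_nonneg fun x _ => mul_nonneg (π.pos x).le (by positivity)
  have hmean := Real.arith_mean_le_rpow_mean Finset.univ π.w (fun x => |ψ x| ^ p)
    (fun x _ => (π.pos x).le) π.sum_eq_one (fun x _ => by positivity) ((one_le_div hp).2 hpq)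
  simp only [← Real.rpow_mul (abs_nonneg _), mul_div_cancel₀ _ hp.ne'] at hmean
  have hroot := Real.rpow_le_rpow (hsum p) hmean (one_div_pos.2 hp).le
  rwa [← Real.rpow_mul (hsum q), show 1 / (q / p) * (1 / p) = 1 / q by field_simp] at hroot

theorem norm_one_centered_add_one (ζ : stdSimplex ℝ V) : π.norm 1 (centered π ζ + 1) = 1 := by
  rw [π.norm_one_eq, ← ζ.2.2]
  refine Finset.sum_congr rfl fun x _ => ?_
  have hx := π.pos x
  have hdensity : (centered π ζ + 1) x = ζ.1 x / π.w x := sub_add_cancel _ _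
  rw [hdensity, abs_of_nonneg (div_nonneg (ζ.2.1 x) hx.le), mul_div_cancel₀ _ hx.ne']

theorem norm_two_sq_centered_add_one (ζ : stdSimplex ℝ V) :
    π.norm 2 (centered π ζ + 1) ^ 2 = sqDist π ζ + 1 := by
  have hmean := (meanZero_iff π).1 (meanZero_centered π ζ)
  rw [π.norm_two_eq, Real.sq_sqrt (inner_self_nonneg π _), map_add, map_add, LinearMap.add_apply,
    LinearMap.add_apply, inner_comm π _ 1, hmean, inner_one_one, sqDist_apply]
  ring

end Norm

section Decay

variable {G : WeightedGraph V} {π : SiteWeights V}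

theorem NashInequality.rpow_sqDist_add_one_le {d tNash T : ℝ}
    (hNash : NashInequality G π d tNash T) (ζ : stdSimplex ℝ V) :
    (sqDist π ζ + 1) ^ (1 + 2 / d) ≤
      tNash * (energy G π (edgeWeight π) ζ + T⁻¹ * (sqDist π ζ + 1)) := by
  have h := hNash (centered π ζ + 1)
  have hform : dirichletForm G π (centered π ζ + 1) = energy G π (edgeWeight π) ζ :=
    dirichletForm_add_const G π (centered π ζ) 1
  rwa [norm_one_centered_add_one, Real.one_rpow, mul_one, hform,
    Real.rpow_mul (π.norm_nonneg 2 _), Real.rpow_two, norm_two_sq_centered_add_one] at h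

theorem NashInequality.rpow_expectation_sqDist_le {d tNash T q t : ℝ}
    (hNash : NashInequality G π d tNash T) (hq : 1 ≤ q) (hqd : q ≤ 1 + 2 / d) (ht : 0 ≤ t)
    (η : stdSimplex ℝ V) :
    (expectation G π η t (sqDist π) + 1) ^ q ≤
      tNash * expectation G π η t (energy G π (edgeWeight π)) +
        tNash / T * (expectation G π η t (sqDist π) + 1) := by
  have hjensen := rpow_expectation_le G π η (F := sqDist π + 1)
    (H := tNash • (energy G π (edgeWeight π) + T⁻¹ • (sqDist π + 1))) hq ht
    (fun ζ => add_nonneg (sqDist_nonneg π ζ) zero_le_one)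
    fun ζ => (Real.rpow_le_rpow_of_exponent_le (le_add_of_nonneg_left (sqDist_nonneg π ζ))
      hqd).trans (hNash.rpow_sqDist_add_one_le ζ)
  simp only [map_smul, map_add, expectation_one G π η ht, smul_eq_mul] at hjensen
  rwa [mul_add, ← mul_assoc, ← div_eq_mul_inv] at hjensen

theorem NashInequality.expectation_sqDist_le {d tNash T ν t : ℝ}
    (hNash : NashInequality G π d tNash T) (hd : 0 < d) (htNash : 0 < tNash) (hT : 0 < T)
    (hν : 0 < ν) (hdν : d ≤ 2 * ν) (ht : 0 < t) (η : stdSimplex ℝ V) :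
    expectation G π η t (sqDist π) ≤
      (2 * (tNash / T)) ^ ν + (2 * tNash * ν / t) ^ ν := by
  have hexp : 1 / ν ≤ 2 / d := by
    rw [div_le_div_iff₀ hν hd]
    linarith
  refine (le_add_of_nonneg_right zero_le_one).trans <|
    le_rpow_add_rpow_of_nash (y := fun s => expectation G π η s (sqDist π) + 1) htNash
      (by positivity) hν ht
      (fun s hs => add_pos_of_nonneg_of_pos
        (expectation_nonneg G π η hs.1 (sqDist_nonneg π)) one_pos)
      (fun s hs => expectation_nonneg G π η hs.1 fun ζ => dirichletForm_nonneg G π _)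
      (fun s _ => (hasDerivAt_expectation_sqDist G π η s).add_const 1)
      fun s hs => hNash.rpow_expectation_sqDist_le (le_add_of_nonneg_right (by positivity))
        (by linarith) hs.1 η

/-- Ultracontractivity of order `ν`: from every initial state, the expected squared distance at
`ε` relaxation times is at most `M ε^{-ν}` for `0 < ε ≤ 1`. -/
def ShortTimeBound (G : WeightedGraph V) (π : SiteWeights V) (ν M : ℝ) : Prop :=
  ∀ η, ∀ e ∈ Set.Ioc (0 : ℝ) 1,
    expectation G π η (e / spectralGap G π) (sqDist π) ≤ M * e ^ (-ν)

theorem NashInequality.shortTimeBound {d tNash T a b ν : ℝ}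
    (hNash : NashInequality G π d tNash T) (hg : 0 < spectralGap G π)
    (hd : 0 < d) (htNash : 0 < tNash) (hT : 0 < T)
    (hν : 0 < ν) (hdν : d ≤ 2 * ν) (ha : tNash ≤ a * relaxationTime G π) (hb : tNash ≤ b * T) :
    ShortTimeBound G π ν ((2 * b) ^ ν + (2 * a * ν) ^ ν) := by
  intro η e ⟨he, he1⟩
  rw [relaxationTime, ← div_eq_mul_inv, le_div_iff₀ hg] at ha
  rw [← div_le_iff₀ hT] at hb
  have hb0 : 0 < b := (div_pos htNash hT).trans_le hb
  have ha0 : 0 < a := (mul_pos htNash hg).trans_le ha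
  have hlong : (2 * (tNash / T)) ^ ν ≤ (2 * b) ^ ν * e ^ (-ν) :=
    (Real.rpow_le_rpow (by positivity) (by linarith) hν.le).trans
      (le_mul_of_one_le_right (by positivity)
        (Real.one_le_rpow_of_pos_of_le_one_of_nonpos he he1 (by linarith)))
  have hshort : (2 * tNash * ν / (e / spectralGap G π)) ^ ν ≤ (2 * a * ν) ^ ν * e ^ (-ν) := by
    rw [Real.rpow_neg he.le, ← Real.inv_rpow he.le, ← Real.mul_rpow (by positivity)
      (by positivity), ← div_eq_mul_inv, div_div_eq_mul_div, mul_right_comm _ ν]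
    refine Real.rpow_le_rpow (by positivity) (div_le_div_of_nonneg_right ?_ he.le) hν.le
    nlinarith
  rw [add_mul]
  exact (hNash.expectation_sqDist_le hd htNash hT hν hdν (div_pos he hg) η).trans
    (add_le_add hlong hshort)

namespace ShortTimeBound

variable {ν M : ℝ}

theorem expectation_sqDist_relaxationTime_le (h : ShortTimeBound G π ν M) (η : stdSimplex ℝ V) :
    expectation G π η (1 / spectralGap G π) (sqDist π) ≤ M := by
  simpa using h η 1 ⟨one_pos, le_rfl⟩

theorem nonneg (h : ShortTimeBound G π ν M) : 0 ≤ M := by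
  classical
  obtain ⟨x⟩ := G.connected.nonempty
  exact (expectation_nonneg G π _ (one_div_nonneg.2 (spectralGap_nonneg G π))
    (sqDist_nonneg π)).trans (h.expectation_sqDist_relaxationTime_le (stdSimplex.vertex x))

end ShortTimeBound

theorem Eigenbasis.heatNormSq_dipole_le (B : Eigenbasis G π) {r M : ℝ} (hr : 0 ≤ r)
    (h : ∀ η, expectation G π η r (sqDist π) ≤ M) (x y : V) :
    B.heatNormSq r (dipole π x y) ≤ 4 * M := by
  classical
  have hvertex : ∀ z, B.heatNormSq r (centered π (stdSimplex.vertex z)) ≤ M := fun z =>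
    (B.heatNormSq_centered_le _ hr).trans (h _)
  rw [dipole_eq_centered_sub]
  linarith [B.heatNormSq_sub_le r (centered π (stdSimplex.vertex x))
    (centered π (stdSimplex.vertex y)), hvertex x, hvertex y]

/-! ### Decay of the squared distance -/

namespace ShortTimeBound

variable {ν M w e t : ℝ}

theorem edgeWeight_mul_heatNormSq_dipole_le (h : ShortTimeBound G π ν M)
    (hg : 0 < spectralGap G π) (hw : ∀ x, π.w x ≤ w) (B : Eigenbasis G π)
    (he : e ∈ Set.Ioc (0 : ℝ) 1) {r : ℝ} (hr : e / spectralGap G π ≤ r) (x y : V) :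
    edgeWeight π x y * B.heatNormSq r (dipole π x y) ≤
      4 * Real.exp 2 * M * w * e ^ (-ν) * Real.exp (-(2 * spectralGap G π * r)) := by
  have hheat := B.heatNormSq_dipole_le (div_nonneg he.1.le hg.le) (fun η => h η e he) x y
  have hexp : Real.exp (-(2 * spectralGap G π * (r - e / spectralGap G π))) ≤
      Real.exp 2 * Real.exp (-(2 * spectralGap G π * r)) := by
    rw [← Real.exp_add, Real.exp_le_exp]
    have : spectralGap G π * (e / spectralGap G π) = e := mul_div_cancel₀ _ hg.ne'
    linarith [he.2]
  calc edgeWeight π x y * B.heatNormSq r (dipole π x y)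
      ≤ w * (Real.exp 2 * Real.exp (-(2 * spectralGap G π * r)) * (4 * (M * e ^ (-ν)))) :=
        mul_le_mul ((edgeWeight_le_left π x y).trans (hw x))
          ((B.heatNormSq_le (meanZero_dipole π x y) hr).trans
            (mul_le_mul hexp hheat (B.heatNormSq_nonneg _ _) (by positivity)))
          (B.heatNormSq_nonneg _ _) ((π.pos x).le.trans (hw x))
    _ = _ := by ring

theorem expectation_sqDist_le_half (h : ShortTimeBound G π ν M) (hg : 0 < spectralGap G π)
    (hw : ∀ x, π.w x ≤ w) (he : e ∈ Set.Ioc (0 : ℝ) 1) (het : e ≤ t) (η : stdSimplex ℝ V) :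
    expectation G π η (t / spectralGap G π) (sqDist π) ≤
      1 / 2 * expectation G π η ((t - e) / spectralGap G π) (sqDist π) + 1 / 2 *
        ((Real.exp (-(2 * t)) + 8 * Real.exp 2 * M * w * e ^ (-ν) * Real.exp (-t))
          * sqDist π η) := by
  obtain ⟨B⟩ := nonempty_eigenbasis G π
  obtain ⟨x⟩ := G.connected.nonempty
  have hw0 : 0 ≤ w := (π.pos x).le.trans (hw x)
  have hM := h.nonneg
  have hpow := Real.rpow_nonneg he.1.le (-ν)
  have hcancel : spectralGap G π * (t / spectralGap G π) = t := mul_div_cancel₀ _ hg.ne'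
  have hhalf := B.expectation_sqDist_le_half η (div_nonneg he.1.le hg.le)
    (div_le_div_of_nonneg_right het hg.le) (by positivity)
    fun r hr x y => h.edgeWeight_mul_heatNormSq_dipole_le hg hw B he hr x y
  rw [← sub_div, mul_assoc 2 (spectralGap G π), hcancel] at hhalf
  linarith

theorem expectation_sqDist_le_mul_sqDist (h : ShortTimeBound G π ν M)
    (hg : 0 < spectralGap G π) (hw : ∀ x, π.w x ≤ w) (hν : 1 ≤ ν) (ht : 0 ≤ t)
    (η : stdSimplex ℝ V) :
    expectation G π η ((t + 4 * ν) / spectralGap G π) (sqDist π) ≤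
      (Real.exp (-(2 * t)) + 12 * Real.exp 2 * M * w * Real.exp (-t)) * sqDist π η := by
  obtain ⟨x⟩ := G.connected.nonempty
  have hw0 : 0 ≤ w := (π.pos x).le.trans (hw x)
  have hM := h.nonneg
  have hv := sqDist_nonneg π η
  have hbound := le_of_half_contraction
    (v := fun s => expectation G π η (s / spectralGap G π) (sqDist π)) (t := t)
    (A := Real.exp (-(2 * t)) * sqDist π η)
    (B := 8 * Real.exp 2 * M * w * Real.exp (-t) * sqDist π η) (K := sqDist π η) hν
    (by positivity) (fun s hs => ?_) fun s e he hts => ?_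
  · linarith
  · have := expectation_sqDist_antitone G π η le_rfl (div_nonneg (ht.trans hs) hg.le)
    rwa [expectation_zero] at this
  · have hpow := Real.rpow_nonneg he.1.le (-ν)
    have hexp2 : Real.exp (-(2 * s)) ≤ Real.exp (-(2 * t)) :=
      Real.exp_le_exp.2 (by linarith [he.1])
    have hexp : Real.exp (-s) ≤ Real.exp (-t) := Real.exp_le_exp.2 (by linarith [he.1])
    refine (h.expectation_sqDist_le_half hg hw he (by linarith) η).trans ?_
    have : (Real.exp (-(2 * s)) + 8 * Real.exp 2 * M * w * e ^ (-ν) * Real.exp (-s)) * sqDist π η ≤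
        (Real.exp (-(2 * t)) + 8 * Real.exp 2 * M * w * e ^ (-ν) * Real.exp (-t)) * sqDist π η := by
      gcongr
    linarith

theorem expectation_sqDist_le (h : ShortTimeBound G π ν M) (hg : 0 < spectralGap G π)
    (hw : ∀ x, π.w x ≤ w) (hν : 1 ≤ ν) (ht : 0 ≤ t) (η : stdSimplex ℝ V) :
    expectation G π η ((t + 4 * ν + 1) / spectralGap G π) (sqDist π) ≤
      (Real.exp (-(2 * t)) + 12 * Real.exp 2 * M * w * Real.exp (-t)) * M := by
  obtain ⟨x⟩ := G.connected.nonempty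
  have hw0 : 0 ≤ w := (π.pos x).le.trans (hw x)
  have hM := h.nonneg
  rw [add_comm, add_div]
  refine (expectation_add_le G π η (one_div_nonneg.2 hg.le)
    (H := (Real.exp (-(2 * t)) + 12 * Real.exp 2 * M * w * Real.exp (-t)) • sqDist π)
    fun ζ => h.expectation_sqDist_le_mul_sqDist hg hw hν ht ζ).trans ?_
  rw [map_smul, smul_eq_mul]
  exact mul_le_mul_of_nonneg_left (h.expectation_sqDist_relaxationTime_le η) (by positivity)

end ShortTimeBound

end Decay

/-! ### The expected distance to equilibrium -/

section ExpectedDist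

variable (π : SiteWeights V) {p : ℝ}

theorem continuous_norm_centered (hp : 0 ≤ p) : Continuous fun ζ => π.norm p (centered π ζ) :=
  (continuous_finsetSum _ fun x _ => continuous_const.mul
    ((continuous_centered_apply π x).abs.rpow_const fun _ => Or.inr hp)).rpow_const
    fun _ => Or.inr (one_div_nonneg.2 hp)

/-- The `L^p` distance `η ↦ ‖η / π - 1‖_p` to equilibrium. -/
def distFun (hp : 0 ≤ p) : C(stdSimplex ℝ V, ℝ) :=
  ⟨fun ζ => π.norm p (centered π ζ), continuous_norm_centered π hp⟩

theorem distFun_sq_le (hp : 1 ≤ p) (hp2 : p ≤ 2) (ζ : stdSimplex ℝ V) :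
    distFun π (zero_le_one.trans hp) ζ ^ (2 : ℝ) ≤ sqDist π ζ := by
  have hle : distFun π (zero_le_one.trans hp) ζ ≤ √(sqDist π ζ) :=
    (π.norm_le_norm (one_pos.trans_le hp) hp2 _).trans_eq (π.norm_two_eq _)
  rw [Real.rpow_two, ← Real.sq_sqrt (sqDist_nonneg π ζ)]
  exact pow_le_pow_left₀ (π.norm_nonneg p _) hle 2

theorem coordFun_le_mul_distFun (hp : 1 ≤ p) {f : V → ℝ} {m : ℝ} (hm : 0 ≤ m)
    (hf : ∀ x, |f x| ≤ m) (ζ : stdSimplex ℝ V) :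
    coordFun π f ζ ≤ m * distFun π (zero_le_one.trans hp) ζ := by
  calc coordFun π f ζ ≤ m * π.norm 1 (centered π ζ) := by
        rw [coordFun_apply, inner_apply, SiteWeights.norm_one_eq, Finset.mul_sum]
        refine Finset.sum_le_sum fun x _ => ?_
        have hx : centered π ζ x * f x ≤ m * |centered π ζ x| := by
          refine (le_abs_self _).trans ?_
          rw [abs_mul, mul_comm]
          exact mul_le_mul_of_nonneg_right (hf x) (abs_nonneg _)
        nlinarith [π.pos x]
    _ ≤ m * distFun π (zero_le_one.trans hp) ζ :=
        mul_le_mul_of_nonneg_left (π.norm_le_norm one_pos hp _) hm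

variable (G : WeightedGraph V)

theorem expectedDist_eq (hp : 0 ≤ p) (t : ℝ≥0) (η : stdSimplex ℝ V) :
    expectedDist G π p t η = ENNReal.ofReal (expectation G π η t (distFun π hp)) := by
  rw [expectation_eq_integral_law, ofReal_integral_eq_lintegral_ofReal]
  · rfl
  · exact (distFun π hp).continuous.integrable_of_hasCompactSupport (.of_compactSpace _)
  · exact ae_of_all _ fun ζ => π.norm_nonneg p _

variable {G π} {t : ℝ}

theorem worstDist_le (hp : 1 ≤ p) (hp2 : p ≤ 2) (ht : 0 ≤ t) {r : ℝ} (hr : 0 ≤ r)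
    (h : ∀ η, expectation G π η t (sqDist π) ≤ r ^ 2) :
    worstDist G π p t.toNNReal ≤ ENNReal.ofReal r := by
  have hp0 : 0 ≤ p := zero_le_one.trans hp
  refine iSup_le fun η => ?_
  have hjensen := rpow_expectation_le G π η one_le_two ht (fun ζ => π.norm_nonneg p _)
    (distFun_sq_le π hp hp2)
  rw [Real.rpow_two] at hjensen
  rw [expectedDist_eq π G hp0, Real.coe_toNNReal t ht]
  exact ENNReal.ofReal_le_ofReal (le_of_sq_le_sq (hjensen.trans (h η)) hr)

theorem exp_neg_le_expectation_distFun [DecidableEq V] (hp : 1 ≤ p) (ht : 0 ≤ t) {f : V → ℝ}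
    {c : ℝ} (hf : singleGenerator G π f = -c • f) (hmean : MeanZero π f) {z : V} (hz : 0 < f z)
    (hmax : ∀ x, |f x| ≤ f z) :
    Real.exp (-(c * t)) ≤
      expectation G π (stdSimplex.vertex z) t (distFun π (zero_le_one.trans hp)) := by
  have hgen : generator G π (coordFun π f) = -c • coordFun π f := by
    rw [generator_coordFun, hf, map_smul]
  have hle := expectation_mono G π (stdSimplex.vertex z) ht (F := coordFun π f)
    (H := f z • distFun π (zero_le_one.trans hp)) (coordFun_le_mul_distFun π hp hz.le hmax)
  rw [expectation_eq_exp_mul G π _ ht hgen, coordFun_vertex π hmean, map_smul, smul_eq_mul,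
    mul_comm, neg_mul] at hle
  exact le_of_mul_le_mul_left hle hz

theorem ofReal_exp_le_worstDist (hV : 1 < Fintype.card V) (hp : 1 ≤ p) (ht : 0 ≤ t) :
    ENNReal.ofReal (Real.exp (-(spectralGap G π * t))) ≤ worstDist G π p t.toNNReal := by
  classical
  obtain ⟨f, z, hf, hmean, hz, hmax⟩ := exists_gap_eigenfunction G π hV
  refine le_iSup_of_le (stdSimplex.vertex z) ?_
  rw [expectedDist_eq π G (zero_le_one.trans hp), Real.coe_toNNReal t ht]
  exact ENNReal.ofReal_le_ofReal (exp_neg_le_expectation_distFun hp ht hf hmean hz hmax)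

end ExpectedDist

/-! ### The two time scales -/

section TimeScales

variable {G : WeightedGraph V} {π : SiteWeights V} {n k : ℕ} {C p : ℝ}

theorem two_mul_log_le_log (hn : 0 < n) (hk : n ^ 2 ≤ k) : 2 * Real.log n ≤ Real.log k := by
  have hle : (n : ℝ) ^ 2 ≤ k := mod_cast hk
  have hlog := Real.log_le_log (by positivity) hle
  rwa [Real.log_pow, Nat.cast_two] at hlog

theorem preCutoffFactor_mem_Icc (hn : 1 < n) (hk : n ^ 2 ≤ k) :
    preCutoffFactor n k ∈ Set.Icc (1 : ℝ) 2 := by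
  have hlogn : 0 < Real.log n := Real.log_pos (mod_cast hn)
  have hlogk : 2 * Real.log n ≤ Real.log k := two_mul_log_le_log (by lia) hk
  have hk0 : (k : ℝ) ≠ 0 := mod_cast ((pow_pos (by lia) 2).trans_le hk).ne'
  have hn0 : (n : ℝ) ≠ 0 := mod_cast (by lia)
  rw [preCutoffFactor, Real.log_div hk0 hn0, ← mul_div_assoc, Set.mem_Icc,
    le_div_iff₀ (by linarith), div_le_iff₀ (by linarith)]
  constructor <;> linarith

theorem timePlus_relaxationTime (hk : 1 < k) :
    timePlus (relaxationTime G π) C n k = (Real.log (k / n) + C) / spectralGap G π := by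
  have hlog : Real.log k ≠ 0 := (Real.log_pos (mod_cast hk)).ne'
  rw [timePlus, preCutoffFactor, relaxationTime]
  field_simp

theorem timeMinus_relaxationTime :
    timeMinus (relaxationTime G π) C k = (Real.log k / 2 - C) / spectralGap G π := by
  rw [timeMinus, relaxationTime]
  ring

theorem timePlus_nonneg (hn : 1 < n) (hk : n ^ 2 ≤ k) (hC : 0 ≤ C) :
    0 ≤ timePlus (relaxationTime G π) C n k := by
  have hkn : n ≤ k := (Nat.le_self_pow two_ne_zero n).trans hk
  rw [timePlus_relaxationTime (hn.trans_le hkn)]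
  have hone : (1 : ℝ) ≤ k / n :=
    (one_le_div (mod_cast one_pos.trans hn)).2 (mod_cast hkn)
  exact div_nonneg (add_nonneg (Real.log_nonneg hone) hC) (spectralGap_nonneg G π)

theorem timeMinus_nonneg (hn : 0 < n) (hk : n ^ 2 ≤ k) (hC : C ≤ Real.log n) :
    0 ≤ timeMinus (relaxationTime G π) C k := by
  rw [timeMinus_relaxationTime]
  exact div_nonneg (by linarith [two_mul_log_le_log hn hk]) (spectralGap_nonneg G π)

theorem ofReal_exp_le_mul_worstDist_timeMinus (hV : 1 < Fintype.card V) (hk : 0 < k)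
    (ht : 0 ≤ timeMinus (relaxationTime G π) C k) (hp : 1 ≤ p) :
    ENNReal.ofReal (Real.exp C) ≤ ENNReal.ofReal √k *
      worstDist G π p (timeMinus (relaxationTime G π) C k).toNNReal := by
  refine le_trans (le_of_eq ?_) (mul_le_mul_right (ofReal_exp_le_worstDist hV hp ht) _)
  have hk0 : (0 : ℝ) < k := Nat.cast_pos.2 hk
  rw [← ENNReal.ofReal_mul (Real.sqrt_nonneg _), timeMinus_relaxationTime,
    mul_div_cancel₀ _ (spectralGap_pos G π hV).ne', neg_sub, Real.exp_sub, Real.exp_half,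
    Real.exp_log hk0, mul_div_cancel₀ _ (Real.sqrt_pos.2 hk0).ne']

theorem exp_neg_two_mul_log_add_le (hn : 0 < n) (hk : n ^ 2 ≤ k) {s : ℝ} (hs : 0 ≤ s) :
    Real.exp (-(2 * (Real.log (k / n) + s))) ≤ Real.exp (-s) / k := by
  have hk0 : (0 : ℝ) < k := mod_cast (pow_pos hn 2).trans_le hk
  have hn0 : (0 : ℝ) < n := mod_cast hn
  rw [← Real.exp_log hk0, ← Real.exp_sub, Real.exp_le_exp, Real.exp_log hk0,
    Real.log_div hk0.ne' hn0.ne']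
  linarith [two_mul_log_le_log hn hk]

theorem exp_neg_log_add (hn : 0 < n) (hk : 0 < k) (s : ℝ) :
    Real.exp (-(Real.log (k / n) + s)) = n / k * Real.exp (-s) := by
  rw [neg_add, Real.exp_add, Real.exp_neg (Real.log _),
    Real.exp_log (div_pos (mod_cast hk) (mod_cast hn)), inv_div]

namespace ShortTimeBound

variable {ν M c : ℝ}

theorem expectation_sqDist_timePlus_le (h : ShortTimeBound G π ν M) (hV : 1 < Fintype.card V)
    (hw : ∀ x, π.w x ≤ c / Fintype.card V) (hν : 1 ≤ ν) (hc : 0 ≤ c)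
    (hk : Fintype.card V ^ 2 ≤ k) (hC : 4 * ν + 1 ≤ C) (η : stdSimplex ℝ V) :
    expectation G π η (timePlus (relaxationTime G π) C (Fintype.card V) k) (sqDist π) ≤
      Real.exp (-(C - (4 * ν + 1))) * ((1 + 12 * Real.exp 2 * M * c) * M) / k := by
  set n := Fintype.card V
  set s := C - (4 * ν + 1) with hs_def
  have hM : 0 ≤ M := h.nonneg
  have hs : 0 ≤ s := sub_nonneg.2 hC
  have hkn : n ≤ k := (Nat.le_self_pow two_ne_zero n).trans hk
  have hn0 : (0 : ℝ) < n := mod_cast one_pos.trans hV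
  have hk0 : (0 : ℝ) < k := mod_cast (one_pos.trans hV).trans_le hkn
  have htime : timePlus (relaxationTime G π) C n k =
      (Real.log (k / n) + s + 4 * ν + 1) / spectralGap G π := by
    rw [timePlus_relaxationTime (hV.trans_le hkn), hs_def]
    ring
  have ht : 0 ≤ Real.log (k / n) + s :=
    add_nonneg (Real.log_nonneg ((one_le_div hn0).2 (mod_cast hkn))) hs
  rw [htime]
  calc _ ≤ _ := h.expectation_sqDist_le (spectralGap_pos G π hV) hw hν ht η
    _ ≤ (Real.exp (-s) / k + 12 * Real.exp 2 * M * (c / n) * (n / k * Real.exp (-s))) * M := by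
      rw [exp_neg_log_add (by lia) (by lia)]
      gcongr
      exact exp_neg_two_mul_log_add_le (by lia) hk hs
    _ = Real.exp (-s) * ((1 + 12 * Real.exp 2 * M * c) * M) / k := by field_simp

theorem mul_worstDist_timePlus_le (h : ShortTimeBound G π ν M) (hV : 1 < Fintype.card V)
    (hw : ∀ x, π.w x ≤ c / Fintype.card V) (hν : 1 ≤ ν) (hc : 0 ≤ c)
    (hk : Fintype.card V ^ 2 ≤ k) (hC : 4 * ν + 1 ≤ C) (hp : p ∈ Set.Icc (1 : ℝ) 2) :
    ENNReal.ofReal √k *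
        worstDist G π p (timePlus (relaxationTime G π) C (Fintype.card V) k).toNNReal ≤
      ENNReal.ofReal √(Real.exp (-(C - (4 * ν + 1))) * ((1 + 12 * Real.exp 2 * M * c) * M)) := by
  have hk0 : (0 : ℝ) < k := mod_cast (pow_pos (one_pos.trans hV) 2).trans_le hk
  have hM : 0 ≤ M := h.nonneg
  have hle := worstDist_le hp.1 hp.2 (timePlus_nonneg hV hk (by linarith)) (Real.sqrt_nonneg _)
    fun η => (h.expectation_sqDist_timePlus_le hV hw hν hc hk hC η).trans_eq
      (Real.sq_sqrt (by positivity)).symm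
  refine (mul_le_mul_right hle _).trans_eq ?_
  rw [← ENNReal.ofReal_mul (Real.sqrt_nonneg _), ← Real.sqrt_mul hk0.le,
    mul_div_cancel₀ _ hk0.ne']

end ShortTimeBound

end TimeScales

theorem SiteWeights.weight_le_of_iSup_div_iInf_le [Nonempty V] (π : SiteWeights V) {c : ℝ}
    (h : (⨆ x, π.w x) / (⨅ y, π.w y) ≤ c) (hc : 0 ≤ c) (x : V) :
    π.w x ≤ c / Fintype.card V := by
  obtain ⟨y, hy⟩ := exists_eq_ciInf_of_finite (f := π.w)
  have hinf : ∀ z, π.w y ≤ π.w z := fun z => hy ▸ ciInf_le (Finite.bddBelow_range π.w) z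
  rw [← hy, div_le_iff₀ (π.pos y)] at h
  have hmean : Fintype.card V * π.w y ≤ 1 := by
    simpa [π.sum_eq_one] using Finset.card_nsmul_le_sum Finset.univ π.w (π.w y) fun z _ => hinf z
  rw [le_div_iff₀ (Nat.cast_pos.2 Fintype.card_pos)]
  calc π.w x * Fintype.card V ≤ c * π.w y * Fintype.card V := by
        gcongr
        exact (le_ciSup (Finite.bddAbove_range π.w) x).trans h
    _ = c * (Fintype.card V * π.w y) := by ring
    _ ≤ c := mul_le_of_le_one_right hc hmean

section Assumptions

variable {V : ℕ → Type*} [∀ j, Fintype (V j)] {G : ∀ j, WeightedGraph (V j)}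
  {π : ∀ j, SiteWeights (V j)}

theorem UniformlyElliptic.exists_weight_le (h : UniformlyElliptic π)
    (hV : ∀ j, Nonempty (V j)) :
    ∃ c, 0 ≤ c ∧ ∀ j x, (π j).w x ≤ c / Fintype.card (V j) := by
  obtain ⟨c, hc, hle⟩ := h
  have hc0 : 0 ≤ c := zero_le_one.trans hc
  exact ⟨c, hc0, fun j x => (π j).weight_le_of_iSup_div_iInf_le (hle j) hc0 x⟩

theorem FiniteDimensional.exists_shortTimeBound (h : FiniteDimensional G π)
    (hgap : ∀ᶠ j in atTop, 0 < spectralGap (G j) (π j)) :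
    ∃ ν M, 1 ≤ ν ∧ ∀ᶠ j in atTop, ShortTimeBound (G j) (π j) ν M := by
  obtain ⟨d, tNash, T, hpos, hNash, hd, htNash, hT⟩ := h
  obtain ⟨D, hD⟩ := hd.bound
  obtain ⟨a, ha⟩ := htNash.bound
  obtain ⟨b, hb⟩ := hT.2.bound
  refine ⟨max D 1, (2 * b) ^ max D 1 + (2 * a * max D 1) ^ max D 1, le_max_right D 1, ?_⟩
  filter_upwards [hgap, hD, ha, hb] with j hg hDj haj hbj
  obtain ⟨hd0, htNash0, hT0⟩ := hpos j
  rw [Real.norm_of_nonneg hd0.le, norm_one, mul_one] at hDj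
  rw [Real.norm_of_nonneg htNash0.le, relaxationTime,
    Real.norm_of_nonneg (inv_nonneg.2 hg.le)] at haj
  rw [Real.norm_of_nonneg htNash0.le, Real.norm_of_nonneg hT0.le] at hbj
  exact (hNash j).shortTimeBound hg hd0 htNash0 hT0 (by positivity)
    (by linarith [le_max_left D 1]) haj hbj

theorem eventually_sq_le_of_tendsto_div {n k : ℕ → ℕ} (hn : Tendsto n atTop atTop)
    (hk : Tendsto (fun j => (k j : ℝ) / (n j : ℝ) ^ 2) atTop atTop) :
    ∀ᶠ j in atTop, n j ^ 2 ≤ k j := by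
  filter_upwards [hn.eventually_gt_atTop 0, hk.eventually_ge_atTop 1] with j hnj hkj
  have hpos : (0 : ℝ) < (n j : ℝ) ^ 2 := by positivity
  exact_mod_cast (one_le_div hpos).1 hkj

theorem exists_const_sqrt_exp_le {δ : ℝ} (hδ : 0 < δ) (c A : ℝ) :
    ∃ C, 0 < C ∧ c ≤ C ∧ 1 / δ ≤ Real.exp C ∧ √(Real.exp (-(C - c)) * A) ≤ δ := by
  have hlim : Tendsto (fun C => √(Real.exp (-(C - c)) * A)) atTop (𝓝 0) := by
    have hexp := Real.tendsto_exp_neg_atTop_nhds_zero.comp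
      (tendsto_atTop_add_const_right atTop (-c) tendsto_id)
    simpa [sub_eq_add_neg] using (hexp.mul_const A).sqrt
  exact ((eventually_gt_atTop 0).and <| (eventually_ge_atTop c).and <|
    (Real.tendsto_exp_atTop.eventually_ge_atTop (1 / δ)).and
      (hlim.eventually_le_const hδ)).exists

end Assumptions

end

end Averaging

theorem mainTheorem8_general {V : ℕ → Type*} [∀ j, Fintype (V j)]
    (G : ∀ j, Averaging.WeightedGraph (V j)) (π : ∀ j, Averaging.SiteWeights (V j))
    (hcard : Tendsto (fun j => Fintype.card (V j)) atTop atTop)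
    (hNash : Averaging.FiniteDimensional G π) (hEll : Averaging.UniformlyElliptic π)
    {δ : ℝ} (hδ : 0 < δ) :
    ∃ C : ℝ, 0 < C ∧ ∀ k : ℕ → ℕ, (∀ᶠ j in atTop, Fintype.card (V j) ^ 2 ≤ k j) →
      (∀ᶠ j in atTop, Averaging.preCutoffFactor (Fintype.card (V j)) (k j) ∈ Set.Icc (1 : ℝ) 2) ∧
      (∀ᶠ j in atTop,
        0 ≤ Averaging.timePlus (Averaging.relaxationTime (G j) (π j)) C
          (Fintype.card (V j)) (k j) ∧
        0 ≤ Averaging.timeMinus (Averaging.relaxationTime (G j) (π j)) C (k j)) ∧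
      ∀ p ∈ Set.Icc (1 : ℝ) 2,
        limsup (fun j => ENNReal.ofReal (Real.sqrt (k j)) *
          Averaging.worstDist (G j) (π j) p
            (Averaging.timePlus (Averaging.relaxationTime (G j) (π j)) C
              (Fintype.card (V j)) (k j)).toNNReal) atTop ≤ ENNReal.ofReal δ ∧
        ENNReal.ofReal (1 / δ) ≤
          liminf (fun j => ENNReal.ofReal (Real.sqrt (k j)) *
            Averaging.worstDist (G j) (π j) p
              (Averaging.timeMinus (Averaging.relaxationTime (G j) (π j)) C (k j)).toNNReal)
            atTop := by
  have hV : ∀ᶠ j in atTop, 1 < Fintype.card (V j) := hcard.eventually_gt_atTop 1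
  obtain ⟨ν, M, hν, hM⟩ := hNash.exists_shortTimeBound
    (hV.mono fun j hj => Averaging.spectralGap_pos (G j) (π j) hj)
  obtain ⟨c, hc, hw⟩ := hEll.exists_weight_le fun j => (G j).connected.nonempty
  obtain ⟨C, hC, hCν, hlower, hupper⟩ := Averaging.exists_const_sqrt_exp_le hδ (4 * ν + 1)
    ((1 + 12 * Real.exp 2 * M * c) * M)
  refine ⟨C, hC, fun k hk => ?_⟩
  have hlog := (Real.tendsto_log_atTop.comp
    (tendsto_natCast_atTop_atTop.comp hcard)).eventually_ge_atTop C
  have hminus : ∀ᶠ j in atTop,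
      0 ≤ Averaging.timeMinus (Averaging.relaxationTime (G j) (π j)) C (k j) := by
    filter_upwards [hV, hk, hlog] with j hVj hkj hlogj
    exact Averaging.timeMinus_nonneg (one_pos.trans hVj) hkj hlogj
  refine ⟨?_, ?_, fun p hp => ⟨limsup_le_of_le (h := ?_), le_liminf_of_le (h := ?_)⟩⟩
  · filter_upwards [hV, hk] with j hVj hkj using Averaging.preCutoffFactor_mem_Icc hVj hkj
  · filter_upwards [hV, hk, hminus] with j hVj hkj hminusj
    exact ⟨Averaging.timePlus_nonneg hVj hkj hC.le, hminusj⟩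
  · filter_upwards [hV, hk, hM] with j hVj hkj hMj
    exact (hMj.mul_worstDist_timePlus_le hVj (hw j) hν hc hkj hCν hp).trans
      (ENNReal.ofReal_le_ofReal hupper)
  · filter_upwards [hV, hk, hminus] with j hVj hkj hminusj
    exact (ENNReal.ofReal_le_ofReal hlower).trans
      (Averaging.ofReal_exp_le_mul_worstDist_timeMinus hVj
        ((pow_pos (one_pos.trans hVj) 2).trans_le hkj) hminusj hp.1)

theorem mainTheorem8 {V : ℕ → Type*} [∀ j, Fintype (V j)]
    (G : ∀ j, Averaging.WeightedGraph (V j)) (π : ∀ j, Averaging.SiteWeights (V j))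
    (hcard : Tendsto (fun j => Fintype.card (V j)) atTop atTop)
    (hNash : Averaging.FiniteDimensional G π) (hEll : Averaging.UniformlyElliptic π)
    (δ : ℝ) (hδ : δ ∈ Set.Ioo (0 : ℝ) 1) :
    ∃ C : ℝ, 0 < C ∧ ∀ k : ℕ → ℕ,
      Tendsto (fun j => (k j : ℝ) / (Fintype.card (V j) : ℝ) ^ 2) atTop atTop →
      (∀ᶠ j in atTop, Averaging.preCutoffFactor (Fintype.card (V j)) (k j) ∈ Set.Icc (1 : ℝ) 2) ∧
      (∀ᶠ j in atTop,
        0 ≤ Averaging.timePlus (Averaging.relaxationTime (G j) (π j)) C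
          (Fintype.card (V j)) (k j) ∧
        0 ≤ Averaging.timeMinus (Averaging.relaxationTime (G j) (π j)) C (k j)) ∧
      ∀ p ∈ Set.Icc (1 : ℝ) 2,
        limsup (fun j => ENNReal.ofReal (Real.sqrt (k j)) *
          Averaging.worstDist (G j) (π j) p
            (Averaging.timePlus (Averaging.relaxationTime (G j) (π j)) C
              (Fintype.card (V j)) (k j)).toNNReal) atTop ≤ ENNReal.ofReal δ ∧
        ENNReal.ofReal (1 / δ) ≤
          liminf (fun j => ENNReal.ofReal (Real.sqrt (k j)) *
            Averaging.worstDist (G j) (π j) p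
              (Averaging.timeMinus (Averaging.relaxationTime (G j) (π j)) C (k j)).toNNReal)
            atTop := by
  obtain ⟨C, hC, h⟩ := mainTheorem8_general G π hcard hNash hEll hδ.1
  exact ⟨C, hC, fun k hk => h k (Averaging.eventually_sq_le_of_tendsto_div hcard hk)⟩
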